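/- Let $\mathcal A=(S,\Sigma,\iota,F,\delta)$ be a complete deterministic finite automaton that is minimal (no complete deterministic automaton over $\Sigma$ with fewer states recognizes $L(\mathcal A)$) and whose language is an ideal, i.e. whenever $u\in L(\mathcal A)$ is a (scattered) subword of $v\in\Sigma^*$, also $v\in L(\mathcal A)$. Write $|\mathcal A|=|S|$. An intersection decomposition of $\mathcal A$ is a finite sequence $\mathcal A_1,\dots,\mathcal A_m$ ($m\ge 1$) of complete deterministic automata over $\Sigma$ that are trim (every state is accessible from the initial state, and from every state some accepting state is accessible), with $|\mathcal A_i|<|\mathcal A|$ for all $i$ and $L(\mathcal A)=\bigcap_{i=1}^m L(\mathcal A_i)$. On a unit-cost random access machine (with addition and subtraction, and words of $O(\log(|\mathcal A||\Sigma|))$ bits), given $\mathcal A$ by its transition table, it can be decided in time $O(|\mathcal A||\Sigma|)$ whether $\mathcal A$ has an intersection decomposition, and if it has one, an intersection decomposition can be constructed in time $O(|\mathcal A||\Sigma|^2)$. The constants do not depend on $\mathcal A$ or $\Sigma$. (If $\Sigma=\emptyset$, both times are $O(1)$.) -/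

import Mathlib

/-! ## Ideals, minimal automata, intersection decompositions

A complete deterministic automaton is Mathlib's `DFA`; its size is the number of its states. -/

namespace IdealDecomposition

/-- A language is an ideal if it contains every upper-word of each of its words. -/
def IsIdeal {α : Type*} (L : Language α) : Prop :=
  ∀ u v : List α, u ∈ L → u.Sublist v → v ∈ L

/-- No automaton over the same alphabet with fewer states recognizes the same language. -/
def IsMinimal {α σ : Type*} [Fintype σ] (M : DFA α σ) : Prop :=
  ∀ (m : ℕ) (N : DFA α (Fin m)), N.accepts = M.accepts → Fintype.card σ ≤ m

/-- Every state is accessible from the initial state, and from every state some accepting state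
is accessible. -/
def IsTrim {α σ : Type*} (M : DFA α σ) : Prop :=
  (∀ q : σ, ∃ w : List α, M.eval w = q) ∧ ∀ q : σ, ∃ w : List α, M.evalFrom q w ∈ M.accept

/-- `D` is an intersection decomposition of `M`: a nonempty finite sequence of trim automata, each
with fewer states than `M`, whose languages intersect to the language of `M`. -/
def IsIntersectionDecomposition {α σ : Type*} [Fintype σ] (M : DFA α σ)
    (D : List ((m : ℕ) × DFA α (Fin m))) : Prop :=
  D ≠ [] ∧
  (∀ N ∈ D, N.1 < Fintype.card σ ∧ IsTrim N.2) ∧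
  ∀ w : List α, w ∈ M.accepts ↔ ∀ N ∈ D, w ∈ N.2.accepts

/-- `M` has an intersection decomposition, i.e. it is composite for intersection. -/
def HasIntersectionDecomposition {α σ : Type*} [Fintype σ] (M : DFA α σ) : Prop :=
  ∃ D : List ((m : ℕ) × DFA α (Fin m)), IsIntersectionDecomposition M D

open scoped Classical in
/-- The description of an automaton given to an algorithm: number of states, number of letters,
initial state, one accepting bit per state, and the transition table row by row (the row of a state
lists its successors under the letters `0, 1, …`). -/
noncomputable def encodeDFA {n k : ℕ} (M : DFA (Fin k) (Fin n)) : List ℕ :=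
  [n, k, (M.start : ℕ)]
    ++ List.ofFn (fun q : Fin n => if q ∈ M.accept then 1 else 0)
    ++ (List.ofFn fun q : Fin n => List.ofFn fun a : Fin k => (M.step q a : ℕ)).flatten

/-- The description of a finite sequence of automata: its length, followed by the descriptions of
its members. -/
noncomputable def encodeList {k : ℕ} (D : List ((m : ℕ) × DFA (Fin k) (Fin m))) : List ℕ :=
  D.length :: (D.map fun N => encodeDFA N.2).flatten

end IdealDecomposition

/-! ## Random access machines

The usual random access machine: a finite program, a memory of cells `0, 1, 2, …`, indirect
addressing, addition and subtraction, a read-once input and a write-once output. Each instruction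
costs one unit of time. The contents of the memory are also kept track of, so that one can ask for
words of logarithmic length. -/

namespace RAM

/-- Instructions. Arguments named `i`, `j`, `l` are addresses of memory cells, and `p` is a position
in the program. -/
inductive Instr where
  /-- cell `i` gets the constant `c` -/
  | const (i c : ℕ)
  /-- cell `i` gets the sum of cells `j` and `l` -/
  | add (i j l : ℕ)
  /-- cell `i` gets the truncated difference of cells `j` and `l` -/
  | sub (i j l : ℕ)
  /-- cell `i` gets the content of the cell whose address is in cell `j` -/
  | load (i j : ℕ)
  /-- the cell whose address is in cell `i` gets the content of cell `j` -/
  | store (i j : ℕ)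
  /-- cell `i` gets the next entry of the input (`0` when the input is exhausted) -/
  | read (i : ℕ)
  /-- the content of cell `i` is appended to the output -/
  | print (i : ℕ)
  /-- continue at position `p` -/
  | jump (p : ℕ)
  /-- continue at position `p` if cell `i` is positive -/
  | jumpPos (i p : ℕ)

/-- A program; the machine halts when the program counter leaves it. -/
abbrev Program := List Instr

/-- Configurations: program counter, memory, input still to be read, output written so far. -/
structure Config where
  pc : ℕ
  mem : ℕ → ℕ
  input : List ℕ
  output : List ℕ

/-- The initial configuration on input `x`: all memory cells are `0`. -/
def start (x : List ℕ) : Config := ⟨0, fun _ => 0, x, []⟩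

/-- The effect of one instruction. -/
def exec (s : Config) : Instr → Config
  | .const i c => { s with pc := s.pc + 1, mem := Function.update s.mem i c }
  | .add i j l => { s with pc := s.pc + 1, mem := Function.update s.mem i (s.mem j + s.mem l) }
  | .sub i j l => { s with pc := s.pc + 1, mem := Function.update s.mem i (s.mem j - s.mem l) }
  | .load i j => { s with pc := s.pc + 1, mem := Function.update s.mem i (s.mem (s.mem j)) }
  | .store i j => { s with pc := s.pc + 1, mem := Function.update s.mem (s.mem i) (s.mem j) }
  | .read i => { s with
      pc := s.pc + 1
      mem := Function.update s.mem i (s.input.headD 0)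
      input := s.input.tail }
  | .print i => { s with pc := s.pc + 1, output := s.output ++ [s.mem i] }
  | .jump p => { s with pc := p }
  | .jumpPos i p => { s with pc := if 0 < s.mem i then p else s.pc + 1 }

/-- One step of the machine; a halted machine stays as it is. -/
def step (P : Program) (s : Config) : Config :=
  match P[s.pc]? with
  | some c => exec s c
  | none => s

/-- The configuration after `t` steps on input `x`. -/
def run (P : Program) (x : List ℕ) (t : ℕ) : Config := (step P)^[t] (start x)

/-- On input `x` the program halts after at most `T` steps with output `y`, and no memory cell ever
holds a number greater than `W`. -/
def ComputesWithin (P : Program) (x y : List ℕ) (T W : ℕ) : Prop :=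
  P.length ≤ (run P x T).pc ∧ (run P x T).output = y ∧ ∀ t i : ℕ, (run P x t).mem i ≤ W

end RAM

/-! In an automaton for an ideal, reading a letter can only enlarge the language of the current
state; if the automaton is minimal, the language grows strictly unless the letter is a loop. So
loops are the only cycles, and the states can be numbered `0, …, N` along the transitions. If `N >
0`, the initial state comes first and the only accepting state, a sink, comes last
(`IsMinimal.isOrdered`).

For ordered automata decomposability is a local matter. The automaton is indecomposable if and only
if every `p` with `p + 1 < N` has a letter to `p + 1` (`HasEdge`) and a letter that takes `p` to `p`
or `p + 1` but moves `p + 1` (`HasGap`).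

Let `p` be the last state that fails, and `q = p + 1`. Removing `q` and redirecting to `q + 1`
affects only words whose run visits `q`. Removing `p` does no harm to those words: without an edge
their runs avoid `p`, so `p` can be redirected to the accepting state; with an edge but no gap, `p`
can be merged into `q`, because every letter read in `p` on the way to `q` loops at `q`. Both
automata accept all of the ideal, and every rejected word is rejected by one of them
(`IsOrdered.isIntersectionDecomposition`).

If no state fails, there are blocks `v i` that move `i` to `i + 1` and `i + 1` beyond itself. The
product of the blocks up to `N - 2` ends in `N - 1` and is rejected, hence rejected by some factor
with at most `N` states. One of these states accepts every continuation and is avoided, so two of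
the `N` prefixes made of blocks reach the same state. Repeating the part between them does not
change the verdict of the factor, but it puts the given automaton one state ahead for good, and the
word becomes accepted (`IsOrdered.not_hasIntersectionDecomposition`).

The algorithm sorts the states topologically by counting unprocessed incoming transitions, compares
consecutive rows of the renumbered table, and prints two modified tables, all in time `O(n k)`. It
is written in a small structured language. `Cmd.computesWithin` transfers results to machine code,
`wp` yields correctness together with a bound on all numbers, and `Cmd.time_le_cost` yields the
running time. -/

/-! ## Structured programs for random access machines -/

namespace RAM

/-- Variables of structured programs. -/
inductive Var where
  | one | zero | size | letters | size1 | size2 | start | idx | idx1 | sym | ptr | ptr2 | state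
  | dest | val | tail | hasEdge | hasGap | found | target | cut

/-- Arrays of structured programs. -/
inductive Arr where
  | table | row | cnt | ord | pos | sorted

theorem Var.ctorIdx_injective : Function.Injective Var.ctorIdx := by
  intro x y h
  cases x <;> cases y <;> first | rfl | exact absurd h (by decide)

theorem Arr.ctorIdx_injective : Function.Injective Arr.ctorIdx := by
  intro x y h
  cases x <;> cases y <;> first | rfl | exact absurd h (by decide)

theorem Arr.ctorIdx_lt (A : Arr) : A.ctorIdx < 6 := by
  cases A <;> decide

instance : DecidableEq Var := fun _ _ => decidable_of_iff _ Var.ctorIdx_injective.eq_iff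

instance : DecidableEq Arr := fun _ _ => decidable_of_iff _ Arr.ctorIdx_injective.eq_iff

/-- States of structured programs: variables, arrays, remaining input, output. -/
structure St where
  v : Var → ℕ
  arr : Arr → ℕ → ℕ
  inp : List ℕ
  out : List ℕ

/-- Assignment to a variable. -/
def St.set (σ : St) (x : Var) (m : ℕ) : St := { σ with v := Function.update σ.v x m }

/-- Assignment to an array entry. -/
def St.setArr (σ : St) (A : Arr) (i m : ℕ) : St :=
  { σ with arr := Function.update σ.arr A (Function.update (σ.arr A) i m) }

/-- Elementary operations. -/
inductive Op where
  | set (x : Var) (c : ℕ)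
  | copy (x y : Var)
  | add (x y z : Var)
  | sub (x y z : Var)
  | inc (x : Var)
  | get (x : Var) (A : Arr) (y : Var)
  | put (A : Arr) (y x : Var)
  | read (x : Var)
  | print (x : Var)

/-- The effect of an elementary operation. -/
def Op.eval (σ : St) : Op → St
  | .set x c => σ.set x c
  | .copy x y => σ.set x (σ.v y)
  | .add x y z => σ.set x (σ.v y + σ.v z)
  | .sub x y z => σ.set x (σ.v y - σ.v z)
  | .inc x => σ.set x (σ.v x + 1)
  | .get x A y => σ.set x (σ.arr A (σ.v y))
  | .put A y x => σ.setArr A (σ.v y) (σ.v x)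
  | .read x => { σ.set x (σ.inp.headD 0) with inp := σ.inp.tail }
  | .print x => { σ with out := σ.out ++ [σ.v x] }

/-- The operation creates no number greater than `V`, provided that there was none before. -/
def Op.Safe (V : ℕ) (σ : St) : Op → Prop
  | .set _ c => c ≤ V
  | .add _ y z => σ.v y + σ.v z ≤ V
  | .inc x => σ.v x + 1 ≤ V
  | _ => True

/-- The machine code of an operation. Variable number `x` is kept in cell `8 x`, entry `j` of array
number `A` in cell `8 j + A + 1`, and cells `7` and `15` are scratch memory. -/
def Op.code : Op → List Instr
  | .set x c => [.const (8 * x.ctorIdx) c]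
  | .copy x y => [.const 7 0, .add (8 * x.ctorIdx) (8 * y.ctorIdx) 7]
  | .add x y z => [.add (8 * x.ctorIdx) (8 * y.ctorIdx) (8 * z.ctorIdx)]
  | .sub x y z => [.sub (8 * x.ctorIdx) (8 * y.ctorIdx) (8 * z.ctorIdx)]
  | .inc x => [.const 7 1, .add (8 * x.ctorIdx) (8 * x.ctorIdx) 7]
  | .get x A y => [.add 7 (8 * y.ctorIdx) (8 * y.ctorIdx), .add 7 7 7, .add 7 7 7,
      .const 15 (A.ctorIdx + 1), .add 7 7 15, .load (8 * x.ctorIdx) 7]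
  | .put A y x => [.add 7 (8 * y.ctorIdx) (8 * y.ctorIdx), .add 7 7 7, .add 7 7 7,
      .const 15 (A.ctorIdx + 1), .add 7 7 15, .store 7 (8 * x.ctorIdx)]
  | .read x => [.read (8 * x.ctorIdx)]
  | .print x => [.print (8 * x.ctorIdx)]

/-- Conditions of branching commands. -/
inductive Test where
  | lt (x y : Var)
  | ne (x y : Var)

/-- The meaning of a condition. -/
def Test.Holds (σ : St) : Test → Prop
  | .lt x y => σ.v x < σ.v y
  | .ne x y => σ.v x ≠ σ.v y

instance (σ : St) (b : Test) : Decidable (b.Holds σ) := by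
  cases b <;> unfold Test.Holds <;> infer_instance

/-- Code that makes cell `7` positive if and only if the condition holds. -/
def Test.code : Test → List Instr
  | .lt x y => [.sub 7 (8 * y.ctorIdx) (8 * x.ctorIdx)]
  | .ne x y => [.sub 7 (8 * x.ctorIdx) (8 * y.ctorIdx), .sub 15 (8 * y.ctorIdx) (8 * x.ctorIdx),
      .add 7 7 15]

/-- Structured programs. The command `loop x y c` repeats `c` for `x = 0, …, y - 1`. -/
inductive Cmd where
  | skip
  | op (o : Op)
  | seq (c d : Cmd)
  | ite (b : Test) (c d : Cmd)
  | loop (x y : Var) (c : Cmd)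

/-- The state before round `j` of a loop over `x` with body `f`. -/
def loopIter (f : St → St) (x : Var) (σ : St) : ℕ → St
  | 0 => σ.set x 0
  | j + 1 => (f (loopIter f x σ j)).set x (j + 1)

/-- The effect of a program. -/
def Cmd.eval : Cmd → St → St
  | .skip, σ => σ
  | .op o, σ => o.eval σ
  | .seq c d, σ => d.eval (c.eval σ)
  | .ite b c d, σ => if b.Holds σ then c.eval σ else d.eval σ
  | .loop x y c, σ => loopIter c.eval x σ (σ.v y)

/-- The program creates no number greater than `V`, provided that there was none before. -/
def Cmd.Safe (V : ℕ) : Cmd → St → Prop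
  | .skip, _ => True
  | .op o, σ => o.Safe V σ
  | .seq c d, σ => c.Safe V σ ∧ d.Safe V (c.eval σ)
  | .ite b c d, σ => if b.Holds σ then c.Safe V σ else d.Safe V σ
  | .loop x y c, σ => ∀ j < σ.v y, c.Safe V (loopIter c.eval x σ j)

/-- The number of machine instructions executed. -/
def Cmd.time : Cmd → St → ℕ
  | .skip, _ => 0
  | .op o, _ => o.code.length
  | .seq c d, σ => c.time σ + d.time (c.eval σ)
  | .ite b c d, σ => b.code.length + 1 + if b.Holds σ then c.time σ else d.time σ + 1
  | .loop x y c, σ => 4 + ∑ j ∈ Finset.range (σ.v y), (c.time (loopIter c.eval x σ j) + 5)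

/-- The length of the machine code. -/
def Cmd.size : Cmd → ℕ
  | .skip => 0
  | .op o => o.code.length
  | .seq c d => c.size + d.size
  | .ite b c d => b.code.length + 1 + d.size + 1 + c.size
  | .loop _ _ c => 4 + c.size + 3

/-- The machine code of a program that is placed at position `o`. -/
def Cmd.code : Cmd → ℕ → List Instr
  | .skip, _ => []
  | .op o, _ => o.code
  | .seq c d, o => c.code o ++ d.code (o + c.size)
  | .ite b c d, o => b.code ++ ([.jumpPos 7 (o + b.code.length + 1 + d.size + 1)] ++
      (d.code (o + b.code.length + 1) ++
        ([.jump (o + b.code.length + 1 + d.size + 1 + c.size)] ++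
          c.code (o + b.code.length + 1 + d.size + 1))))
  | .loop x y c, o => [.const (8 * x.ctorIdx) 0, .sub 7 (8 * y.ctorIdx) (8 * x.ctorIdx),
      .jumpPos 7 (o + 4), .jump (o + 4 + c.size + 3)] ++ (c.code (o + 4) ++
        [.const 7 1, .add (8 * x.ctorIdx) (8 * x.ctorIdx) 7, .jump (o + 1)])

/-- The variable that an operation changes. -/
def Op.writes : Op → List Var
  | .set x _ | .copy x _ | .add x _ _ | .sub x _ _ | .inc x | .get x _ _ | .read x => [x]
  | .put _ _ _ | .print _ => []

/-- The variables that a program may change. -/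
def Cmd.writes : Cmd → List Var
  | .skip => []
  | .op o => o.writes
  | .seq c d => c.writes ++ d.writes
  | .ite _ c d => c.writes ++ d.writes
  | .loop x _ c => x :: c.writes

/-- The arrays that a program may change. -/
def Cmd.writesArr : Cmd → List Arr
  | .op (.put A _ _) => [A]
  | .skip | .op _ => []
  | .seq c d => c.writesArr ++ d.writesArr
  | .ite _ c d => c.writesArr ++ d.writesArr
  | .loop _ _ c => c.writesArr

/-- Whether a program may read input. -/
def Cmd.reads : Cmd → Bool
  | .op (.read _) => true
  | .skip | .op _ => false
  | .seq c d => c.reads || d.reads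
  | .ite _ c d => c.reads || d.reads
  | .loop _ _ c => c.reads

/-- Whether a program may print. -/
def Cmd.prints : Cmd → Bool
  | .op (.print _) => true
  | .skip | .op _ => false
  | .seq c d => c.prints || d.prints
  | .ite _ c d => c.prints || d.prints
  | .loop _ _ c => c.prints

/-- Loop bodies do not change the loop counter and the loop bound. -/
def Cmd.WF : Cmd → Prop
  | .skip | .op _ => True
  | .seq c d => c.WF ∧ d.WF
  | .ite _ c d => c.WF ∧ d.WF
  | .loop x y c => x ≠ y ∧ x ∉ c.writes ∧ y ∉ c.writes ∧ c.WF

instance Cmd.decidableWF : (c : Cmd) → Decidable c.WF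
  | .skip | .op _ => .isTrue trivial
  | .seq c d | .ite _ c d => @instDecidableAnd _ _ c.decidableWF d.decidableWF
  | .loop _ _ c => @instDecidableAnd _ _ _ (@instDecidableAnd _ _ _
      (@instDecidableAnd _ _ _ c.decidableWF))

/-- The loop bounds of a program. -/
def Cmd.limits : Cmd → List Var
  | .skip | .op _ => []
  | .seq c d => c.limits ++ d.limits
  | .ite _ c d => c.limits ++ d.limits
  | .loop _ y c => y :: c.limits

/-- A bound for the running time in terms of the loop bounds. -/
def Cmd.cost (ρ : Var → ℕ) : Cmd → ℕ
  | .skip => 0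
  | .op o => o.code.length
  | .seq c d => c.cost ρ + d.cost ρ
  | .ite b c d => b.code.length + 1 + (c.cost ρ + (d.cost ρ + 1))
  | .loop _ y c => 4 + ρ y * (c.cost ρ + 5)

/-! ### Frame conditions and running time -/

/-- `σ'` differs from `σ` only where the program `c` may change something. -/
structure Cmd.Frame (c : Cmd) (σ σ' : St) : Prop where
  v : ∀ x, x ∉ c.writes → σ'.v x = σ.v x
  arr : ∀ A, A ∉ c.writesArr → σ'.arr A = σ.arr A
  inp : c.reads = false → σ'.inp = σ.inp
  out : c.prints = false → σ'.out = σ.out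

theorem Op.frame (o : Op) (σ : St) : (Cmd.op o).Frame σ (o.eval σ) := by
  constructor
  · intro x hx
    cases o <;> simp_all [Cmd.writes, Op.writes, Op.eval, St.set, St.setArr]
  · intro A hA
    cases o <;> simp_all [Cmd.writesArr, Op.eval, St.set, St.setArr]
  · intro h
    cases o <;> simp_all [Cmd.reads, Op.eval, St.set, St.setArr]
  · intro h
    cases o <;> simp_all [Cmd.prints, Op.eval, St.set, St.setArr]

theorem frame_loopIter {c : Cmd} (hc : ∀ σ, c.Frame σ (c.eval σ)) (x y : Var) (σ : St) (j : ℕ) :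
    (Cmd.loop x y c).Frame σ (loopIter c.eval x σ j) := by
  induction j with
  | zero => constructor <;> simp +contextual [loopIter, St.set, Cmd.writes]
  | succ j ih =>
    have h := hc (loopIter c.eval x σ j)
    constructor
    · intro z hz
      have hz' : z ≠ x ∧ z ∉ c.writes := by simpa [Cmd.writes] using hz
      simp only [loopIter, St.set]
      rw [Function.update_of_ne hz'.1, h.v z hz'.2, ih.v z hz]
    · intro A hA
      exact (h.arr A hA).trans (ih.arr A hA)
    · intro hr
      exact (h.inp hr).trans (ih.inp hr)
    · intro hr
      exact (h.out hr).trans (ih.out hr)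

theorem Cmd.frame (c : Cmd) : ∀ σ, c.Frame σ (c.eval σ) := by
  induction c with
  | skip => intro σ; constructor <;> intros <;> rfl
  | op o => exact fun σ => o.frame σ
  | seq c d hc hd =>
    intro σ
    have h1 := hc σ
    have h2 := hd (c.eval σ)
    constructor
    · intro x hx
      simp only [writes, List.mem_append, not_or] at hx
      exact (h2.v x hx.2).trans (h1.v x hx.1)
    · intro x hx
      simp only [writesArr, List.mem_append, not_or] at hx
      exact (h2.arr x hx.2).trans (h1.arr x hx.1)
    · intro hx
      simp only [reads, Bool.or_eq_false_iff] at hx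
      exact (h2.inp hx.2).trans (h1.inp hx.1)
    · intro hx
      simp only [prints, Bool.or_eq_false_iff] at hx
      exact (h2.out hx.2).trans (h1.out hx.1)
  | ite b c d hc hd =>
    intro σ
    have h1 := hc σ
    have h2 := hd σ
    constructor
    · intro x hx
      simp only [writes, List.mem_append, not_or] at hx
      simp only [eval]
      split
      exacts [h1.v x hx.1, h2.v x hx.2]
    · intro x hx
      simp only [writesArr, List.mem_append, not_or] at hx
      simp only [eval]
      split
      exacts [h1.arr x hx.1, h2.arr x hx.2]
    · intro hx
      simp only [reads, Bool.or_eq_false_iff] at hx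
      simp only [eval]
      split
      exacts [h1.inp hx.1, h2.inp hx.2]
    · intro hx
      simp only [prints, Bool.or_eq_false_iff] at hx
      simp only [eval]
      split
      exacts [h1.out hx.1, h2.out hx.2]
  | loop x y c hc => exact fun σ => frame_loopIter hc x y σ _

/-- Loop bounds lie outside `U`, so they keep their initial values and every loop costs at most its
bound times the cost of a round. The set `U` is fixed during the induction, since a bound in one
part of the program must also survive the other parts. -/
theorem Cmd.time_le_cost (c : Cmd) (U : List Var) (ρ : Var → ℕ) (hU : c.writes ⊆ U) (σ : St)
    (hL : ∀ y ∈ c.limits, y ∉ U ∧ σ.v y ≤ ρ y) : c.time σ ≤ c.cost ρ := by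
  induction c generalizing σ with
  | skip => exact le_rfl
  | op o => exact le_rfl
  | seq c d hc hd =>
    simp only [writes, List.append_subset, limits, List.mem_append] at hU hL
    refine add_le_add (hc hU.1 σ fun y hy => hL y (.inl hy)) (hd hU.2 _ fun y hy => ?_)
    rw [(c.frame σ).v y fun h => (hL y (.inr hy)).1 (hU.1 h)]
    exact hL y (.inr hy)
  | ite b c d hc hd =>
    simp only [writes, List.append_subset, limits, List.mem_append] at hU hL
    have h1 := hc hU.1 σ fun y hy => hL y (.inl hy)
    have h2 := hd hU.2 σ fun y hy => hL y (.inr hy)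
    simp only [time, cost]
    split <;> omega
  | loop x y c hc =>
    simp only [limits, List.mem_cons] at hL
    have hU' : c.writes ⊆ U := fun z hz => hU (List.mem_cons_of_mem _ hz)
    simp only [time, cost]
    refine Nat.add_le_add_left ((Finset.sum_le_card_nsmul _ _ (c.cost ρ + 5) ?_).trans ?_) _
    · intro j _
      refine Nat.add_le_add_right (hc hU' _ fun z hz => ?_) _
      rw [(frame_loopIter c.frame x y σ j).v z fun h => (hL z (.inr hz)).1 (hU h)]
      exact hL z (.inr hz)
    · rw [Finset.card_range, smul_eq_mul]
      exact Nat.mul_le_mul_right _ (hL y (.inl rfl)).2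

/-! ### Correctness of the compiler -/

/-- The code `l` stands at position `o` of the program `P`. -/
def CodeAt (P : Program) (o : ℕ) (l : List Instr) : Prop :=
  ∀ i (h : i < l.length), P[o + i]? = some l[i]

theorem CodeAt.left {P : Program} {o : ℕ} {l l' : List Instr} (h : CodeAt P o (l ++ l')) :
    CodeAt P o l := fun i hi => by
  rw [h i (by simp; omega), List.getElem_append_left hi]

theorem CodeAt.right {P : Program} {o : ℕ} {l l' : List Instr} (h : CodeAt P o (l ++ l')) :
    CodeAt P (o + l.length) l' := fun i hi => by
  rw [Nat.add_assoc, h _ (by simp; omega)]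
  simp

theorem CodeAt.head {P : Program} {o : ℕ} {I : Instr} {l : List Instr}
    (h : CodeAt P o (I :: l)) : P[o]? = some I := h 0 (by simp)

theorem CodeAt.tail {P : Program} {o : ℕ} {I : Instr} {l : List Instr}
    (h : CodeAt P o (I :: l)) : CodeAt P (o + 1) l := CodeAt.right (l := [I]) h

/-- From configuration `s` the machine reaches `s'` in `t` steps, and all numbers in memory are at
most `W` during these steps. -/
def Reach (P : Program) (W t : ℕ) (s s' : Config) : Prop :=
  (step P)^[t] s = s' ∧ ∀ u ≤ t, ∀ i, ((step P)^[u] s).mem i ≤ W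

theorem Reach.refl {P : Program} {W : ℕ} {s : Config} (h : ∀ i, s.mem i ≤ W) :
    Reach P W 0 s s :=
  ⟨rfl, fun u hu => by obtain rfl : u = 0 := by omega
                       exact h⟩

theorem Reach.trans {P : Program} {W t t' : ℕ} {s s' s'' : Config} (h : Reach P W t s s')
    (h' : Reach P W t' s' s'') : Reach P W (t + t') s s'' := by
  obtain ⟨rfl, hb⟩ := h
  obtain ⟨rfl, hb'⟩ := h'
  refine ⟨by rw [Nat.add_comm, Function.iterate_add_apply], fun u hu i => ?_⟩
  rcases le_total u t with hut | hut
  · exact hb u hut i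
  · obtain ⟨w, rfl⟩ := Nat.exists_eq_add_of_le hut
    rw [Nat.add_comm, Function.iterate_add_apply]
    exact hb' w (by omega) i

theorem Reach.single {P : Program} {W : ℕ} {s : Config} {I : Instr} (hI : P[s.pc]? = some I)
    (hs : ∀ i, s.mem i ≤ W) (hs' : ∀ i, (exec s I).mem i ≤ W) : Reach P W 1 s (exec s I) := by
  have h : step P s = exec s I := by simp [step, hI]
  refine ⟨h, fun u hu => ?_⟩
  obtain rfl | rfl : u = 0 ∨ u = 1 := by omega
  · exact hs
  · rw [Function.iterate_one, h]
    exact hs'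

/-- Configuration `s` represents the state `σ`, all of whose numbers are at most `V`. -/
structure Repr (V : ℕ) (σ : St) (s : Config) : Prop where
  v : ∀ x : Var, s.mem (8 * x.ctorIdx) = σ.v x
  arr : ∀ (A : Arr) j, s.mem (8 * j + A.ctorIdx + 1) = σ.arr A j
  inp : s.input = σ.inp
  out : s.output = σ.out
  mem_le : ∀ i, s.mem i ≤ 8 * V + 7
  v_le : ∀ x, σ.v x ≤ V
  arr_le : ∀ A j, σ.arr A j ≤ V
  inp_le : ∀ m ∈ σ.inp, m ≤ V

theorem Repr.pc {V : ℕ} {σ : St} {s : Config} (h : Repr V σ s) (p : ℕ) :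
    Repr V σ { s with pc := p } :=
  ⟨h.v, h.arr, h.inp, h.out, h.mem_le, h.v_le, h.arr_le, h.inp_le⟩

theorem update_le {mem : ℕ → ℕ} {W : ℕ} (h : ∀ i, mem i ≤ W) {m : ℕ} (hm : m ≤ W) (j : ℕ) :
    ∀ i, Function.update mem j m i ≤ W := by
  intro i
  rw [Function.update_apply]
  split
  exacts [hm, h i]

/-- Variables occupy residue 0 modulo 8 and arrays the residues 1 to 6, so cells of residue 7
represent nothing. They may hold up to `8 * V + 7` instead of `V` because addresses of array entries
are formed there. -/
theorem Repr.temp {V : ℕ} {σ : St} {s : Config} (h : Repr V σ s) (p : ℕ) {i m : ℕ}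
    (hi : i % 8 = 7) (hm : m ≤ 8 * V + 7) :
    Repr V σ { s with pc := p, mem := Function.update s.mem i m } where
  v x := by rw [← h.v]; exact Function.update_of_ne (by omega) _ _
  arr A j := by
    have := A.ctorIdx_lt
    rw [← h.arr]; exact Function.update_of_ne (by omega) _ _
  inp := h.inp
  out := h.out
  mem_le := update_le h.mem_le hm _
  v_le := h.v_le
  arr_le := h.arr_le
  inp_le := h.inp_le

theorem Repr.set {V : ℕ} {σ : St} {s : Config} (h : Repr V σ s) (p : ℕ) (x : Var) {m : ℕ}
    (hm : m ≤ V) :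
    Repr V (σ.set x m) { s with pc := p, mem := Function.update s.mem (8 * x.ctorIdx) m } where
  v y := by
    by_cases hy : y = x
    · subst hy; simp [St.set]
    · have : y.ctorIdx ≠ x.ctorIdx := fun e => hy (Var.ctorIdx_injective e)
      simp only [St.set]
      rw [Function.update_of_ne hy, ← h.v, Function.update_of_ne (by omega)]
  arr A j := by
    have := A.ctorIdx_lt
    exact (Function.update_of_ne (by omega) _ _).trans (h.arr A j)
  inp := h.inp
  out := h.out
  mem_le := update_le h.mem_le (by omega) _
  v_le y := by
    simp only [St.set, Function.update_apply]
    split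
    exacts [hm, h.v_le y]
  arr_le := h.arr_le
  inp_le := h.inp_le

theorem Repr.setArr {V : ℕ} {σ : St} {s : Config} (h : Repr V σ s) (p : ℕ) (A : Arr) (j : ℕ)
    {m : ℕ} (hm : m ≤ V) :
    Repr V (σ.setArr A j m)
      { s with pc := p, mem := Function.update s.mem (8 * j + A.ctorIdx + 1) m } where
  v y := by
    have := A.ctorIdx_lt
    exact (Function.update_of_ne (by omega) _ _).trans (h.v y)
  arr B i := by
    have := A.ctorIdx_lt
    have := B.ctorIdx_lt
    by_cases hB : B = A
    · subst hB
      simp only [St.setArr, Function.update_self]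
      by_cases hi : i = j
      · subst hi; simp
      · rw [Function.update_of_ne hi, ← h.arr, Function.update_of_ne (by omega)]
    · have : B.ctorIdx ≠ A.ctorIdx := fun e => hB (Arr.ctorIdx_injective e)
      simp only [St.setArr]
      rw [Function.update_of_ne hB, ← h.arr, Function.update_of_ne (by omega)]
  inp := h.inp
  out := h.out
  mem_le := update_le h.mem_le (by omega) _
  v_le := h.v_le
  arr_le B i := by
    simp only [St.setArr, Function.update_apply]
    split
    · rw [Function.update_apply]
      split
      exacts [hm, h.arr_le A i]
    · exact h.arr_le B i
  inp_le := h.inp_le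

/-- Started at position `o` in state `σ`, the program reaches position `o'` in state `σ'` after `t`
steps. -/
def Sims (P : Program) (V o t o' : ℕ) (σ σ' : St) : Prop :=
  ∀ s, s.pc = o → Repr V σ s →
    ∃ s', Reach P (8 * V + 7) t s s' ∧ s'.pc = o' ∧ Repr V σ' s'

theorem Sims.refl (P : Program) (V o : ℕ) (σ : St) : Sims P V o 0 o σ σ :=
  fun s hs h => ⟨s, .refl h.mem_le, hs, h⟩

theorem Sims.trans {P : Program} {V o t o' t' o'' : ℕ} {σ σ' σ'' : St}
    (h : Sims P V o t o' σ σ') (h' : Sims P V o' t' o'' σ' σ'') :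
    Sims P V o (t + t') o'' σ σ'' := by
  intro s hs hr
  obtain ⟨s1, h1, hs1, hr1⟩ := h s hs hr
  obtain ⟨s2, h2, hs2, hr2⟩ := h' s1 hs1 hr1
  exact ⟨s2, h1.trans h2, hs2, hr2⟩

theorem Sims.jump {P : Program} {V o p : ℕ} (h : P[o]? = some (.jump p)) (σ : St) :
    Sims P V o 1 p σ σ := by
  rintro s rfl hr
  exact ⟨_, .single h hr.mem_le hr.mem_le, rfl, hr.pc _⟩

theorem Repr.step_temp {P : Program} {V : ℕ} {σ : St} {s : Config} (hr : Repr V σ s) {I : Instr}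
    (hI : P[s.pc]? = some I) (i m : ℕ)
    (he : exec s I = { s with pc := s.pc + 1, mem := Function.update s.mem i m })
    (hi : i % 8 = 7) (hm : m ≤ 8 * V + 7) :
    ∃ s', Reach P (8 * V + 7) 1 s s' ∧ s'.pc = s.pc + 1 ∧ Repr V σ s' ∧ s'.mem i = m ∧
      ∀ j, j ≠ i → s'.mem j = s.mem j := by
  have r := he ▸ hr.temp (s.pc + 1) hi hm
  exact ⟨_, .single hI hr.mem_le r.mem_le, by simp [he], r, by simp [he], by simp +contextual [he]⟩

theorem Repr.step_set {P : Program} {V : ℕ} {σ : St} {s : Config} (hr : Repr V σ s) {I : Instr}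
    (hI : P[s.pc]? = some I) (x : Var) {m : ℕ}
    (he : exec s I = { s with pc := s.pc + 1, mem := Function.update s.mem (8 * x.ctorIdx) m })
    (hm : m ≤ V) :
    ∃ s', Reach P (8 * V + 7) 1 s s' ∧ s'.pc = s.pc + 1 ∧ Repr V (σ.set x m) s' := by
  have r := he ▸ hr.set (s.pc + 1) x hm
  exact ⟨_, .single hI hr.mem_le r.mem_le, by simp [he], r⟩

theorem Repr.step_setArr {P : Program} {V : ℕ} {σ : St} {s : Config} (hr : Repr V σ s) {I : Instr}
    (hI : P[s.pc]? = some I) (A : Arr) (j : ℕ) {m : ℕ}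
    (he : exec s I =
      { s with pc := s.pc + 1, mem := Function.update s.mem (8 * j + A.ctorIdx + 1) m })
    (hm : m ≤ V) :
    ∃ s', Reach P (8 * V + 7) 1 s s' ∧ s'.pc = s.pc + 1 ∧ Repr V (σ.setArr A j m) s' := by
  have r := he ▸ hr.setArr (s.pc + 1) A j hm
  exact ⟨_, .single hI hr.mem_le r.mem_le, by simp [he], r⟩

theorem Sims.test {P : Program} {V o : ℕ} {σ : St} {b : Test} {p : ℕ}
    (h : CodeAt P o (b.code ++ [.jumpPos 7 p])) :
    Sims P V o (b.code.length + 1) (if b.Holds σ then p else o + b.code.length + 1) σ σ := by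
  intro s hs hr
  obtain ⟨s1, h1, hp1, hr1, h7⟩ : ∃ s1, Reach P (8 * V + 7) b.code.length s s1 ∧
      s1.pc = o + b.code.length ∧ Repr V σ s1 ∧ (0 < s1.mem 7 ↔ b.Holds σ) := by
    subst hs
    cases b with
    | lt x y =>
      have hy := hr.v_le y
      obtain ⟨s1, h1, p1, r1, e1, -⟩ := hr.step_temp h.head 7 (σ.v y - σ.v x)
        (by simp [exec, hr.v]) rfl (by omega)
      exact ⟨s1, h1, p1, r1, by simp [e1, Test.Holds]⟩
    | ne x y =>
      have hx := hr.v_le x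
      have hy := hr.v_le y
      obtain ⟨s1, h1, p1, r1, e1, -⟩ := hr.step_temp h.head 7 (σ.v x - σ.v y)
        (by simp [exec, hr.v]) rfl (by omega)
      obtain ⟨s2, h2, p2, r2, e2, f2⟩ := r1.step_temp (p1 ▸ h.tail.head) 15 (σ.v y - σ.v x)
        (by simp [exec, r1.v]) rfl (by omega)
      obtain ⟨s3, h3, p3, r3, e3, -⟩ := r2.step_temp (p2 ▸ p1 ▸ h.tail.tail.head) 7
        ((σ.v x - σ.v y) + (σ.v y - σ.v x)) (by simp [exec, e2, f2, e1]) rfl (by omega)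
      refine ⟨s3, (h1.trans h2).trans h3, by rw [p3, p2, p1]; rfl, r3, ?_⟩
      simp only [e3, Test.Holds]
      omega
  have hI := h.right.head
  rw [← hp1] at hI
  refine ⟨_, h1.trans (.single hI hr1.mem_le hr1.mem_le), ?_, hr1.pc _⟩
  simp [exec, h7, hp1]

/-- The common part of the code of array accesses. -/
theorem Repr.address {P : Program} {V : ℕ} {σ : St} {s : Config} (hr : Repr V σ s) {A : Arr}
    {y : Var} {I : Instr}
    (h : CodeAt P s.pc [.add 7 (8 * y.ctorIdx) (8 * y.ctorIdx), .add 7 7 7, .add 7 7 7,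
      .const 15 (A.ctorIdx + 1), .add 7 7 15, I]) :
    ∃ s', Reach P (8 * V + 7) 5 s s' ∧ s'.pc = s.pc + 5 ∧ Repr V σ s' ∧
      s'.mem 7 = 8 * σ.v y + A.ctorIdx + 1 ∧ P[s'.pc]? = some I := by
  have hy := hr.v_le y
  have hA := A.ctorIdx_lt
  obtain ⟨s1, h1, p1, r1, e1, -⟩ := hr.step_temp h.head 7 (σ.v y + σ.v y)
    (by simp [exec, hr.v]) rfl (by omega)
  obtain ⟨s2, h2, p2, r2, e2, -⟩ := r1.step_temp (p1 ▸ h.tail.head) 7 (4 * σ.v y)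
    (by simp only [exec, e1]; congr 2; omega) rfl (by omega)
  obtain ⟨s3, h3, p3, r3, e3, -⟩ := r2.step_temp (p2 ▸ p1 ▸ h.tail.tail.head) 7 (8 * σ.v y)
    (by simp only [exec, e2]; congr 2; omega) rfl (by omega)
  obtain ⟨s4, h4, p4, r4, e4, f4⟩ := r3.step_temp (p3 ▸ p2 ▸ p1 ▸ h.tail.tail.tail.head) 15
    (A.ctorIdx + 1) rfl rfl (by omega)
  obtain ⟨s5, h5, p5, r5, e5, -⟩ := r4.step_temp
    (p4 ▸ p3 ▸ p2 ▸ p1 ▸ h.tail.tail.tail.tail.head) 7 (8 * σ.v y + A.ctorIdx + 1)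
    (by simp [exec, e4, f4, e3, Nat.add_assoc]) rfl (by omega)
  exact ⟨s5, (((h1.trans h2).trans h3).trans h4).trans h5, by omega, r5, e5,
    p5 ▸ p4 ▸ p3 ▸ p2 ▸ p1 ▸ h.tail.tail.tail.tail.tail.head⟩

theorem Sims.op {P : Program} {V o : ℕ} {σ : St} {c : Op} (h : CodeAt P o c.code)
    (hc : c.Safe V σ) : Sims P V o c.code.length (o + c.code.length) σ (c.eval σ) := by
  rintro s rfl hr
  cases c with
  | set x m => exact hr.step_set h.head x rfl hc
  | copy x y =>
    obtain ⟨s1, h1, p1, r1, e1, -⟩ := hr.step_temp h.head 7 0 rfl rfl (Nat.zero_le _)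
    obtain ⟨s2, h2, p2, r2⟩ := r1.step_set (p1 ▸ h.tail.head) x (m := σ.v y)
      (by simp [exec, e1, r1.v]) (hr.v_le y)
    exact ⟨s2, h1.trans h2, by rw [p2, p1]; rfl, r2⟩
  | add x y z => exact hr.step_set h.head x (by simp [exec, hr.v]) hc
  | sub x y z =>
    exact hr.step_set h.head x (by simp [exec, hr.v]) ((Nat.sub_le _ (σ.v z)).trans (hr.v_le y))
  | inc x =>
    obtain ⟨s1, h1, p1, r1, e1, -⟩ := hr.step_temp h.head 7 1 rfl rfl (by omega)
    obtain ⟨s2, h2, p2, r2⟩ := r1.step_set (p1 ▸ h.tail.head) x (m := σ.v x + 1)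
      (by simp [exec, e1, r1.v]) hc
    exact ⟨s2, h1.trans h2, by rw [p2, p1]; rfl, r2⟩
  | get x A y =>
    obtain ⟨s1, h1, p1, r1, e1, hI⟩ := hr.address h
    obtain ⟨s2, h2, p2, r2⟩ := r1.step_set hI x (m := σ.arr A (σ.v y))
      (by simp [exec, e1, r1.arr]) (hr.arr_le _ _)
    exact ⟨s2, h1.trans h2, by rw [p2, p1]; rfl, r2⟩
  | put A y x =>
    obtain ⟨s1, h1, p1, r1, e1, hI⟩ := hr.address h
    obtain ⟨s2, h2, p2, r2⟩ := r1.step_setArr hI A (σ.v y) (m := σ.v x)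
      (by simp [exec, e1, r1.v]) (hr.v_le _)
    exact ⟨s2, h1.trans h2, by rw [p2, p1]; rfl, r2⟩
  | read x =>
    have hm : σ.inp.headD 0 ≤ V := by
      cases hl : σ.inp with
      | nil => simp
      | cons m l => exact hr.inp_le m (by simp [hl])
    have r1 := hr.set (s.pc + 1) x hm
    rw [← hr.inp] at r1
    refine ⟨_, .single h.head hr.mem_le r1.mem_le, rfl, ?_⟩
    rw [Op.eval, ← hr.inp]
    exact ⟨r1.v, r1.arr, rfl, r1.out, r1.mem_le, r1.v_le, r1.arr_le,
      fun m hm => hr.inp_le m (hr.inp ▸ List.mem_of_mem_tail hm)⟩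
  | print x =>
    refine ⟨_, .single h.head hr.mem_le hr.mem_le, rfl, ?_⟩
    exact ⟨hr.v, hr.arr, hr.inp, by simp [exec, Op.eval, hr.out, hr.v], hr.mem_le, hr.v_le,
      hr.arr_le, hr.inp_le⟩

theorem Cmd.length_code (c : Cmd) : ∀ o, (c.code o).length = c.size := by
  induction c with
  | skip => intro; rfl
  | op o => intro; rfl
  | seq c d hc hd => intro; simp [code, size, hc, hd]
  | ite b c d hc hd => intro; simp [code, size, hc, hd]; omega
  | loop x y c hc => intro; simp [code, size, hc]; omega

/-- Induction on the program. For a loop, an inner induction on the rounds shows that the machine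
stands at the test, position `o + 1`, in state `loopIter` before each round. -/
theorem Cmd.sims {P : Program} {V : ℕ} (c : Cmd) : ∀ {o : ℕ} {σ : St}, CodeAt P o (c.code o) →
    c.WF → c.Safe V σ → Sims P V o (c.time σ) (o + c.size) σ (c.eval σ) := by
  induction c with
  | skip => intro o σ _ _ _; exact Sims.refl P V o σ
  | op o => intro o' σ h _ hs; exact .op h hs
  | seq c d hc hd =>
    intro o σ h hw hs
    have h2 := h.right
    rw [Cmd.length_code] at h2
    have := (hc h.left hw.1 hs.1).trans (hd h2 hw.2 hs.2)
    rw [Nat.add_assoc] at this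
    exact this
  | ite b c d hc hd =>
    intro o σ h hw hs
    have ht : Sims P V o _ _ σ σ := .test (b := b) (by
      rw [code, ← List.append_assoc] at h
      exact h.left)
    have h2 := h.right.right
    have h3 := h2.right.right
    have h4 := h2.right.head
    simp only [length_code, List.length_singleton] at h2 h3 h4
    simp only [Safe] at hs
    simp only [time, eval, size]
    split at hs
    · rename_i hb
      simp only [if_pos hb] at ht ⊢
      convert ht.trans (hc (by convert h3 using 1) hw.1 hs) using 1
      omega
    · rename_i hb
      simp only [if_neg hb] at ht ⊢
      convert ht.trans ((hd h2.left hw.2 hs).trans (.jump h4 _)) using 1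
      omega
  | loop x y c hc =>
    intro o σ h hw hs
    obtain ⟨hxy, hx, hy, hw⟩ := hw
    have hvx : ∀ j, (loopIter c.eval x σ j).v x = j := by
      intro j; cases j <;> simp [loopIter, St.set]
    have hvy : ∀ j, (loopIter c.eval x σ j).v y = σ.v y := fun j =>
      (frame_loopIter c.frame x y σ j).v y (by simp [writes, hy, hxy.symm])
    have hb := h.right
    have h2 := hb.right
    simp only [length_code, List.length_cons, List.length_nil] at hb h2
    have hinit : Sims P V o 1 (o + 1) σ (loopIter c.eval x σ 0) :=
      Sims.op (c := .set x 0) (CodeAt.left (l := [_]) h) (Nat.zero_le _)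
    have htest (τ : St) : Sims P V (o + 1) 2
        (if (Test.lt x y).Holds τ then o + 4 else o + 3) τ τ :=
      Sims.test (b := .lt x y) (CodeAt.left (l := [_, _]) h.tail)
    have hexit := h.tail.tail.tail.head
    have hround (j : ℕ) (hj : j < σ.v y) : Sims P V (o + 1)
        (c.time (loopIter c.eval x σ j) + 5) (o + 1) (loopIter c.eval x σ j)
        (loopIter c.eval x σ (j + 1)) := by
      have ht := htest (loopIter c.eval x σ j)
      rw [if_pos (by simpa [Test.Holds, hvx, hvy] using hj)] at ht
      have hbody := hc hb.left hw (hs j hj)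
      have hinc : Sims P V (o + 4 + c.size) 2 (o + 4 + c.size + 2)
          (c.eval (loopIter c.eval x σ j)) (loopIter c.eval x σ (j + 1)) := by
        have hj' : (c.eval (loopIter c.eval x σ j)).v x = j := by
          rw [(c.frame _).v x hx, hvx]
        intro s hs' hr
        -- The counter never exceeds the loop bound, which is itself a stored number. This is why
        -- `Cmd.Safe` asks nothing of the counter.
        have hle : j + 1 ≤ V := by
          have := hr.v_le y
          rw [(c.frame _).v y hy, hvy] at this
          omega
        have := Sims.op (c := .inc x) (CodeAt.left (l := [_, _]) h2) (V := V)
          (σ := c.eval (loopIter c.eval x σ j)) (by simpa [Op.Safe, hj'] using hle) s hs' hr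
        rw [Op.eval, hj'] at this
        exact this
      convert ((ht.trans hbody).trans hinc).trans (.jump h2.tail.tail.head _) using 1
      omega
    have hmain (m : ℕ) (hm : m ≤ σ.v y) : Sims P V o
        (1 + ∑ j ∈ Finset.range m, (c.time (loopIter c.eval x σ j) + 5)) (o + 1) σ
        (loopIter c.eval x σ m) := by
      induction m with
      | zero => exact hinit
      | succ m ih =>
        rw [Finset.sum_range_succ, ← Nat.add_assoc]
        exact (ih (by omega)).trans (hround m (by omega))
    have hlast := htest (loopIter c.eval x σ (σ.v y))
    rw [if_neg (by simp [Test.Holds, hvx, hvy])] at hlast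
    convert ((hmain _ le_rfl).trans hlast).trans (.jump hexit _) using 1
    · simp only [time]; omega
    · simp only [size]; omega
    · rfl

/-- The compiled program runs the structured program. -/
theorem Cmd.computesWithin {c : Cmd} (hw : c.WF) {V : ℕ} {x : List ℕ} (hx : ∀ m ∈ x, m ≤ V)
    (hs : c.Safe V ⟨fun _ => 0, fun _ _ => 0, x, []⟩) {T W : ℕ}
    (hT : c.time ⟨fun _ => 0, fun _ _ => 0, x, []⟩ ≤ T) (hW : 8 * V + 7 ≤ W) :
    ComputesWithin (c.code 0) x (c.eval ⟨fun _ => 0, fun _ _ => 0, x, []⟩).out T W := by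
  obtain ⟨s', ⟨h1, hb⟩, hp, hr⟩ := c.sims (P := c.code 0) (V := V) (o := 0)
    (fun i h => by simp [List.getElem?_eq_getElem h]) hw hs (RAM.start x) rfl
    { v := fun _ => rfl, arr := fun _ _ => rfl, inp := rfl, out := rfl,
      mem_le := fun _ => Nat.zero_le _, v_le := fun _ => Nat.zero_le _,
      arr_le := fun _ _ => Nat.zero_le _, inp_le := hx }
  -- A halted machine stays put, so what holds at the exact running time also holds at `T` and at
  -- all later times.
  have hfix (m : ℕ) : (step (c.code 0))^[m] s' = s' :=
    Function.iterate_fixed (by simp [step, hp, c.length_code]) m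
  have hrun (m : ℕ) : run (c.code 0) x (m + c.time ⟨fun _ => 0, fun _ _ => 0, x, []⟩) = s' := by
    rw [run, Function.iterate_add_apply, h1, hfix]
  obtain ⟨m, rfl⟩ := Nat.exists_eq_add_of_le' hT
  refine ⟨by simp [hrun, hp, c.length_code], by rw [hrun, hr.out], fun t i => ?_⟩
  rcases le_total t (c.time ⟨fun _ => 0, fun _ _ => 0, x, []⟩) with ht | ht
  · exact (hb t ht i).trans hW
  · obtain ⟨u, rfl⟩ := Nat.exists_eq_add_of_le' ht
    rw [hrun]
    exact (hr.mem_le i).trans hW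

end RAM

/-! ## Topologically ordered ideal automata -/

namespace IdealDecomposition

variable {α : Type*}

/-- An automaton on `0, …, N` that recognizes a nonempty proper ideal, with all states accessible
and numbered along the transitions. -/
structure IsOrdered {N : ℕ} (M : DFA α (Fin (N + 1))) : Prop where
  le_step : ∀ q a, q ≤ M.step q a
  start : M.start = 0
  accept : ∀ q, q ∈ M.accept ↔ q = Fin.last N
  pred : ∀ q, q ≠ 0 → ∃ p < q, ∃ a, M.step p a = q
  acceptsFrom_le : ∀ q a, M.acceptsFrom q ≤ M.acceptsFrom (M.step q a)
  coaccessible : ∀ q, ∃ w, M.evalFrom q w ∈ M.accept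

/-- Some letter leads from `p` to the next state. -/
def HasEdge {n : ℕ} (M : DFA α (Fin n)) (p : Fin n) : Prop :=
  ∃ a, (M.step p a : ℕ) = p + 1

/-- Some letter leads from `p` to `p` or `q`, but is no loop at `q`. -/
def HasGap {n : ℕ} (M : DFA α (Fin n)) (p q : Fin n) : Prop :=
  ∃ a, (M.step p a = p ∨ M.step p a = q) ∧ M.step q a ≠ q

/-- The run from `q` on the given word visits `c`. -/
def Visits {σ : Type*} (M : DFA α σ) (c : σ) : σ → List α → Prop
  | q, [] => q = c
  | q, a :: w => q = c ∨ Visits M c (M.step q a) w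

theorem Visits.self {σ : Type*} (M : DFA α σ) (c : σ) (w : List α) : Visits M c c w := by
  cases w <;> simp [Visits]

/-- The automaton `M` without state `c`, whose incoming transitions are redirected to the state that
has number `t` afterwards. -/
def redirect {N : ℕ} (M : DFA α (Fin (N + 1))) (c : Fin (N + 1)) (t : Fin N) : DFA α (Fin N) where
  step j a := c.insertNth (α := fun _ => Fin N) t id (M.step (c.succAbove j) a)
  start := c.insertNth (α := fun _ => Fin N) t id M.start
  accept := {j | c.succAbove j ∈ M.accept}

/-! ### Removing a state and redirecting its incoming transitions -/

section Redirect

variable {N : ℕ} {M : DFA α (Fin (N + 1))} {c : Fin (N + 1)} {t : Fin N}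

/-- The number that a state of `M` has in `redirect M c t`. -/
def renumber (c : Fin (N + 1)) (t : Fin N) (x : Fin (N + 1)) : Fin N :=
  c.insertNth (α := fun _ => Fin N) t id x

theorem renumber_self : renumber c t c = t := by simp [renumber]

theorem renumber_succAbove (j : Fin N) : renumber c t (c.succAbove j) = j := by simp [renumber]

theorem succAbove_renumber {x : Fin (N + 1)} (h : x ≠ c) : c.succAbove (renumber c t x) = x := by
  obtain ⟨j, rfl⟩ := Fin.exists_succAbove_eq h
  rw [renumber_succAbove]

theorem renumber_val (x : Fin (N + 1)) : (renumber c t x : ℕ) =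
    if (x : ℕ) = c then (t : ℕ) else if (x : ℕ) < c then (x : ℕ) else x - 1 := by
  split
  · rename_i h
    rw [Fin.ext h, renumber_self]
  · rename_i h
    obtain ⟨j, rfl⟩ := Fin.exists_succAbove_eq (fun e => h (congrArg Fin.val e) : x ≠ c)
    rw [renumber_succAbove]
    rcases lt_or_ge j.castSucc c with hj | hj
    · rw [Fin.succAbove_of_castSucc_lt _ _ hj]
      rw [Fin.lt_def, Fin.val_castSucc] at hj
      simp [hj]
    · rw [Fin.succAbove_of_le_castSucc _ _ hj]
      rw [Fin.le_def, Fin.val_castSucc] at hj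
      simp [show ¬ ((j : ℕ) + 1 < c) by omega]

theorem redirect_step_renumber {x : Fin (N + 1)} (h : x ≠ c) (a : α) :
    (redirect M c t).step (renumber c t x) a = renumber c t (M.step x a) := by
  rw [← succAbove_renumber (t := t) h, renumber_succAbove]
  rfl

theorem renumber_mem_accept {x : Fin (N + 1)} (h : x ≠ c) :
    renumber c t x ∈ (redirect M c t).accept ↔ x ∈ M.accept := by
  change c.succAbove (renumber c t x) ∈ M.accept ↔ _
  rw [succAbove_renumber h]

/-- Redirecting to a state with a larger language enlarges the language. -/
theorem mem_acceptsFrom_redirect (h : M.acceptsFrom c ≤ M.acceptsFrom (c.succAbove t))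
    (w : List α) (x : Fin (N + 1)) (hw : w ∈ M.acceptsFrom x) :
    w ∈ (redirect M c t).acceptsFrom (renumber c t x) := by
  have key (w : List α) : ∀ j, w ∈ M.acceptsFrom (c.succAbove j) →
      w ∈ (redirect M c t).acceptsFrom j := by
    induction w with
    | nil => exact fun j hj => hj
    | cons a w ih =>
      intro j hj
      change w ∈ (redirect M c t).acceptsFrom (renumber c t (M.step (c.succAbove j) a))
      change w ∈ M.acceptsFrom (M.step (c.succAbove j) a) at hj
      apply ih
      by_cases hc : M.step (c.succAbove j) a = c
      · rw [hc] at hj ⊢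
        rw [renumber_self]
        exact h hj
      · rwa [succAbove_renumber hc]
  apply key
  by_cases hc : x = c
  · subst hc
    rw [renumber_self]
    exact h hw
  · rwa [succAbove_renumber hc]

/-- On the word `w`, the run of `redirect M c t` ends in the same state as that of `M`. -/
def Tracks (M : DFA α (Fin (N + 1))) (c : Fin (N + 1)) (t : Fin N) (x : Fin (N + 1))
    (w : List α) : Prop :=
  (redirect M c t).evalFrom (renumber c t x) w = renumber c t (M.evalFrom x w) ∧
    M.evalFrom x w ≠ c

theorem tracks_of_not_visits (w : List α) : ∀ x, ¬ Visits M c x w → Tracks M c t x w := by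
  induction w with
  | nil => exact fun x hx => ⟨rfl, hx⟩
  | cons a w ih =>
    intro x hx
    simp only [Visits, not_or] at hx
    have := ih _ hx.2
    rw [Tracks, DFA.evalFrom_cons, DFA.evalFrom_cons, redirect_step_renumber hx.1]
    exact this

theorem Tracks.accepts_iff {w : List α} (h : Tracks M c t M.start w) :
    w ∈ (redirect M c t).accepts ↔ w ∈ M.accepts := by
  change (redirect M c t).evalFrom (renumber c t M.start) w ∈ (redirect M c t).accept ↔ _
  rw [h.1, renumber_mem_accept h.2]
  rfl

/-- Accessibility goes by induction along the old numbering, so each remaining state needs just one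
smaller remaining predecessor. Coaccessibility is inherited because redirecting to a larger language
keeps every accepted word. -/
theorem isTrim_redirect (hM : ∀ q, ∃ w, M.evalFrom q w ∈ M.accept)
    (h : M.acceptsFrom c ≤ M.acceptsFrom (c.succAbove t))
    (hp : ∀ x ≠ c, renumber c t M.start = renumber c t x ∨
      ∃ p < x, p ≠ c ∧ ∃ a, renumber c t (M.step p a) = renumber c t x) :
    IsTrim (redirect M c t) := by
  constructor
  · have key (x : Fin (N + 1)) : x ≠ c → ∃ w, (redirect M c t).eval w = renumber c t x := by
      induction x using WellFoundedLT.induction with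
      | ind x ih =>
        intro hx
        obtain h0 | ⟨p, hpx, hpc, a, ha⟩ := hp x hx
        · exact ⟨[], h0⟩
        · obtain ⟨w, hw⟩ := ih p hpx hpc
          refine ⟨w ++ [a], ?_⟩
          rw [DFA.eval_append_singleton, hw, redirect_step_renumber hpc, ha]
    intro q
    obtain ⟨w, hw⟩ := key (c.succAbove q) (Fin.succAbove_ne c q)
    exact ⟨w, by rw [hw, renumber_succAbove]⟩
  · intro q
    obtain ⟨w, hw⟩ := hM (c.succAbove q)
    have := mem_acceptsFrom_redirect h w _ hw
    rw [renumber_succAbove] at this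
    exact ⟨w, this⟩

end Redirect

/-! ### The decomposition criterion for ordered automata -/

namespace IsOrdered

variable {N : ℕ} {M : DFA α (Fin (N + 1))}

theorem le_evalFrom (hM : IsOrdered M) (w : List α) : ∀ q, q ≤ M.evalFrom q w := by
  induction w with
  | nil => exact fun q => le_rfl
  | cons a w ih => exact fun q => (hM.le_step q a).trans (ih _)

theorem acceptsFrom_last (hM : IsOrdered M) (L : Language α) :
    L ≤ M.acceptsFrom (Fin.last N) := by
  intro w _
  exact (hM.accept _).2 (Fin.last_le_iff.1 (hM.le_evalFrom w _))

theorem le_of_visits (hM : IsOrdered M) {c : Fin (N + 1)} (w : List α) :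
    ∀ q, Visits M c q w → q ≤ c := by
  induction w with
  | nil => exact fun q h => h.le
  | cons a w ih =>
    rintro q (rfl | h)
    · exact le_rfl
    · exact (hM.le_step q a).trans (ih _ h)

/-- A run that visits two consecutive states uses a transition between them. -/
theorem hasEdge_of_visits (hM : IsOrdered M) {p q : Fin (N + 1)} (hpq : (q : ℕ) = p + 1)
    (w : List α) : ∀ x, Visits M p x w → Visits M q x w → HasEdge M p := by
  induction w with
  | nil =>
    intro x hp hq
    simp only [Visits] at hp hq
    subst hp hq
    omega
  | cons a w ih =>
    rintro x (rfl | hp) (rfl | hq)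
    · omega
    · have h1 := hM.le_of_visits _ _ hq
      have h2 := hM.le_step x a
      rw [Fin.le_def] at h1 h2
      by_cases h : M.step x a = x
      · exact ih _ (by rw [h]; exact Visits.self M x w) hq
      · have : (M.step x a : ℕ) ≠ x := fun e => h (Fin.ext e)
        exact ⟨a, by omega⟩
    · have h1 := hM.le_of_visits _ _ hp
      have h2 := hM.le_step x a
      rw [Fin.le_def] at h1 h2
      omega
    · exact ih _ hp hq

/-- If `p` has no gap, then state `p` can be dropped as far as words through the next state are
concerned. -/
theorem tracks_of_visits (hM : IsOrdered M) {p q : Fin (N + 1)} (hpq : (q : ℕ) = p + 1)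
    (hgap : ¬ HasGap M p q) {t : Fin N} (ht : p.succAbove t = q) (w : List α) :
    ∀ x, Visits M q x w → Tracks M p t x w := by
  have hqp : q ≠ p := fun h => by rw [h] at hpq; omega
  have hlt : p < q := by rw [Fin.lt_def]; omega
  induction w with
  | nil =>
    rintro x rfl
    exact ⟨rfl, hqp⟩
  | cons a w ih =>
    intro x hx
    by_cases hxq : x = q
    · refine tracks_of_not_visits _ _ fun h => ?_
      exact absurd (hM.le_of_visits _ _ h) (by rw [hxq]; exact hlt.not_ge)
    · have hx : Visits M q (M.step x a) w := hx.resolve_left hxq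
      have := ih _ hx
      rw [Tracks, DFA.evalFrom_cons, DFA.evalFrom_cons]
      by_cases hxp : x = p
      · subst hxp
        have h1 := hM.le_of_visits _ _ hx
        have h2 := hM.le_step x a
        rw [Fin.le_def] at h1 h2
        -- The run has yet to visit `q`, so from the removed state it cannot jump past `q`. Without
        -- a gap such a letter loops at `q`, hence the merged state does not move.
        have hst : M.step x a = x ∨ M.step x a = q := by
          simp only [Fin.ext_iff]; omega
        have hq : M.step q a = q := by
          by_contra h
          exact hgap ⟨a, hst, h⟩
        have htq : renumber x t q = t := by rw [← ht, renumber_succAbove]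
        have hst' : renumber x t (M.step x a) = t := by
          rcases hst with h | h
          · rw [h, renumber_self]
          · rw [h, htq]
        have : (redirect M x t).step (renumber x t x) a = renumber x t (M.step x a) := by
          rw [hst', renumber_self]
          have := redirect_step_renumber (M := M) (t := t) hqp a
          rwa [hq, htq] at this
        rwa [this]
      · rwa [redirect_step_renumber hxp]

/-- Otherwise every letter would loop at `N - 1`, from which no accepting state could be reached.
Hence this edge never has to be tested. -/
theorem hasEdge_of_last (hM : IsOrdered M) {p : Fin (N + 1)} (hp : (p : ℕ) + 1 = N) :
    HasEdge M p := by
  obtain ⟨q, hq, a, ha⟩ := hM.pred (Fin.last N) (by rw [Ne, Fin.ext_iff, Fin.val_last]; simp; omega)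
  by_contra hne
  obtain ⟨w, hw⟩ := hM.coaccessible p
  have hstay (a : α) : M.step p a = p := by
    have h1 := hM.le_step p a
    have h2 := (M.step p a).isLt
    have h3 : (M.step p a : ℕ) ≠ p + 1 := fun h => hne ⟨a, h⟩
    rw [Fin.le_def] at h1
    exact Fin.ext (by omega)
  have : M.evalFrom p w = p := by
    clear hw
    induction w with
    | nil => rfl
    | cons a w ih => rw [DFA.evalFrom_cons, hstay, ih]
  rw [this, hM.accept, Fin.ext_iff, Fin.val_last] at hw
  omega

theorem acceptsFrom_le_of_hasEdge (hM : IsOrdered M) {p q : Fin (N + 1)} (hpq : (q : ℕ) = p + 1)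
    (h : HasEdge M p) : M.acceptsFrom p ≤ M.acceptsFrom q := by
  obtain ⟨a, ha⟩ := h
  have : M.step p a = q := Fin.ext (by omega)
  exact this ▸ hM.acceptsFrom_le p a

/-- An ordered automaton that lacks an edge or a gap has an intersection decomposition into two
automata. -/
theorem isIntersectionDecomposition (hM : IsOrdered M) {p q r : Fin (N + 1)}
    (hpq : (q : ℕ) = p + 1) (hqr : (r : ℕ) = q + 1)
    (hedge : ∀ j : Fin (N + 1), p < j → (j : ℕ) + 1 < N → HasEdge M j) {t u : Fin N}
    (hp : ¬ HasEdge M p ∧ p.succAbove t = Fin.last N ∨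
      HasEdge M p ∧ ¬ HasGap M p q ∧ p.succAbove t = q)
    (hu : q.succAbove u = r) :
    IsIntersectionDecomposition M [⟨N, redirect M p t⟩, ⟨N, redirect M q u⟩] := by
  have hlt : p < q := by rw [Fin.lt_def]; omega
  have hr := r.isLt
  have hedge' (j : Fin (N + 1)) (h : p < j) (h' : (j : ℕ) < N) : HasEdge M j := by
    by_cases hj : (j : ℕ) + 1 = N
    · exact hM.hasEdge_of_last hj
    · exact hedge j h (by omega)
  -- Here the choice of `p` as the last failing state pays: all later states have edges, so each
  -- state above `q` is entered from the one just below it. This helps to keep it accessible after a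
  -- removal.
  have hprev (x : Fin (N + 1)) (h : q < x) : ∃ y : Fin (N + 1), (y : ℕ) + 1 = x ∧ y < x ∧
      (∃ a, M.step y a = x) := by
    have hx := x.isLt
    rw [Fin.lt_def] at h
    obtain ⟨a, ha⟩ := hedge' ⟨x - 1, by omega⟩ (by rw [Fin.lt_def]; simp only; omega)
      (by simp only; omega)
    exact ⟨⟨x - 1, by omega⟩, by simp only; omega, by rw [Fin.lt_def]; simp only; omega, a,
      Fin.ext (by rw [ha]; simp only; omega)⟩
  have hple : M.acceptsFrom p ≤ M.acceptsFrom (p.succAbove t) := by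
    rcases hp with ⟨-, ht⟩ | ⟨he, -, ht⟩ <;> rw [ht]
    · exact hM.acceptsFrom_last _
    · exact hM.acceptsFrom_le_of_hasEdge hpq he
  have hqle : M.acceptsFrom q ≤ M.acceptsFrom (q.succAbove u) := by
    rw [hu]
    exact hM.acceptsFrom_le_of_hasEdge hqr (hedge' q hlt (by omega))
  have htrim1 : IsTrim (redirect M p t) := by
    refine isTrim_redirect hM.coaccessible hple fun x hx => ?_
    rcases lt_trichotomy x q with hxq | rfl | hxq
    · by_cases h0 : x = 0
      · left; rw [hM.start, h0]
      · obtain ⟨y, hy, a, ha⟩ := hM.pred x h0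
        refine .inr ⟨y, hy, fun h => ?_, a, by rw [ha]⟩
        rw [Fin.lt_def] at hxq hy
        rw [h] at hy
        omega
    · rcases hp with ⟨he, ht⟩ | ⟨he, hg, ht⟩
      -- As `p` has no edge to `q`, the predecessor of `q` is not the removed state.
      · obtain ⟨y, hy, a, ha⟩ := hM.pred x (fun h => by simp [h] at hpq)
        exact .inr ⟨y, hy, fun h => he ⟨a, by rw [← h, ha, hpq, h]⟩, a, by rw [ha]⟩
      · have hren : renumber p t x = t := by rw [← ht, renumber_succAbove]
        -- The merged state inherits the predecessors of `p`, or is initial if `p` was.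
        by_cases h0 : p = 0
        · left
          rw [hM.start, hren, ← h0, renumber_self]
        · obtain ⟨y, hy, a, ha⟩ := hM.pred p h0
          exact .inr ⟨y, hy.trans hlt, hy.ne, a, by rw [ha, hren, renumber_self]⟩
    · obtain ⟨y, hyx, hy, a, ha⟩ := hprev x hxq
      refine .inr ⟨y, hy, fun h => ?_, a, by rw [ha]⟩
      rw [Fin.lt_def] at hxq
      rw [h] at hyx
      omega
  have htrim2 : IsTrim (redirect M q u) := by
    refine isTrim_redirect hM.coaccessible hqle fun x hx => ?_
    rcases lt_or_gt_of_ne hx with hxq | hxq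
    · by_cases h0 : x = 0
      · left; rw [hM.start, h0]
      · obtain ⟨y, hy, a, ha⟩ := hM.pred x h0
        exact .inr ⟨y, hy, (hy.trans hxq).ne, a, by rw [ha]⟩
    · by_cases hxr : x = r
      · obtain ⟨y, hy, a, ha⟩ := hM.pred q (fun h => by simp [h] at hpq)
        refine .inr ⟨y, hy.trans hxq, hy.ne, a, ?_⟩
        rw [ha, renumber_self, hxr, ← hu, renumber_succAbove]
      · obtain ⟨y, hyx, hy, a, ha⟩ := hprev x hxq
        refine .inr ⟨y, hy, fun h => hxr (Fin.ext ?_), a, by rw [ha]⟩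
        rw [h] at hyx
        omega
  refine ⟨by simp, by simp [htrim1, htrim2], fun w => ?_⟩
  simp only [List.mem_cons, List.not_mem_nil, or_false, forall_eq_or_imp, forall_eq]
  constructor
  · intro hw
    exact ⟨mem_acceptsFrom_redirect hple w _ hw, mem_acceptsFrom_redirect hqle w _ hw⟩
  · rintro ⟨h1, h2⟩
    -- On words whose run visits `q` the first automaton agrees with `M`, on all others the second.
    by_cases hv : Visits M q M.start w
    · refine (Tracks.accepts_iff (t := t) ?_).1 h1
      rcases hp with ⟨he, ht⟩ | ⟨he, hg, ht⟩
      · exact tracks_of_not_visits _ _ fun hv' => he (hM.hasEdge_of_visits hpq w _ hv' hv)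
      · exact hM.tracks_of_visits hpq hg ht w _ hv
    · exact (tracks_of_not_visits _ _ hv).accepts_iff.1 h2

/-- An automaton with all edges and all gaps has no intersection decomposition. -/
theorem not_hasIntersectionDecomposition (hM : IsOrdered M) (hN : 0 < N)
    (h : ∀ p q : Fin (N + 1), (q : ℕ) = p + 1 → (q : ℕ) < N → HasEdge M p ∧ HasGap M p q) :
    ¬ HasIntersectionDecomposition M := by
  -- The block for `i` advances a run at `i` by one and pushes a run at `i + 1` further. The range
  -- condition is inside the existential so that `choose` gives a total family of words.
  have hblock (i : ℕ) : ∃ v : List α, ∀ hi : i + 1 < N,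
      (M.evalFrom ⟨i, by omega⟩ v : ℕ) = i + 1 ∧
        i + 1 < (M.evalFrom ⟨i + 1, by omega⟩ v : ℕ) := by
    by_cases hi : i + 1 < N
    · obtain ⟨⟨a, ha⟩, ⟨b, hb, hb'⟩⟩ := h ⟨i, by omega⟩ ⟨i + 1, by omega⟩ rfl hi
      have hlt : i + 1 < (M.step ⟨i + 1, by omega⟩ b : ℕ) :=
        lt_of_le_of_ne (Fin.le_def.1 (hM.le_step ⟨i + 1, by omega⟩ b)) fun e => hb' (Fin.ext e.symm)
      -- A gap letter that loops at `i` is followed by the edge letter; one that leads to `i + 1`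
      -- suffices alone.
      rcases hb with hb | hb
      · refine ⟨[b, a], fun _ => ⟨by simp [hb, ha], ?_⟩⟩
        exact hlt.trans_le (Fin.le_def.1 (hM.le_evalFrom [a] _))
      · exact ⟨[b], fun _ => ⟨by simp [hb], by simpa using hlt⟩⟩
    · exact ⟨[], fun h => absurd h hi⟩
  choose v hv using hblock
  let seg (i : ℕ) (m : ℕ) : List α := (List.range m).flatMap fun l => v (i + l)
  have seg_succ (i m : ℕ) : seg i (m + 1) = seg i m ++ v (i + m) := by
    simp [seg, List.range_succ]
  have seg_add (i m l : ℕ) : seg i (m + l) = seg i m ++ seg (i + m) l := by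
    induction l with
    | zero => simp [seg]
    | succ l ih => rw [← Nat.add_assoc, seg_succ, ih, seg_succ, Nat.add_assoc, List.append_assoc]
  have hseg (i m : ℕ) (him : i + m < N) :
      (M.evalFrom ⟨i, by omega⟩ (seg i m) : ℕ) = i + m := by
    induction m with
    | zero => simp [seg]
    | succ m ih =>
      have hm := ih (by omega)
      rw [seg_succ, DFA.evalFrom_of_append,
        show M.evalFrom ⟨i, by omega⟩ (seg i m) = ⟨i + m, by omega⟩ from Fin.ext hm,
        (hv (i + m) (by omega)).1, Nat.add_assoc]
  -- A lead is never lost: before each block the run is either at the very next state, and the block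
  -- pushes it on, or already further, and runs do not descend.
  have hahead (i m : ℕ) (him : i + m < N) (s : Fin (N + 1)) (hs : i < (s : ℕ)) :
      i + m < (M.evalFrom s (seg i m) : ℕ) := by
    induction m with
    | zero => simpa [seg] using hs
    | succ m ih =>
      have hm := ih (by omega)
      rw [seg_succ, DFA.evalFrom_of_append]
      rcases Nat.lt_or_ge (i + m + 1) (M.evalFrom s (seg i m)) with h1 | h1
      · exact h1.trans_le (Fin.le_def.1 (hM.le_evalFrom _ _))
      · rw [show M.evalFrom s (seg i m) = ⟨i + m + 1, by omega⟩ from Fin.ext (by simp only; omega)]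
        exact (hv (i + m) (by omega)).2
  have hstart : M.start = ⟨0, by omega⟩ := hM.start
  rintro ⟨D, -, hD, hL⟩
  have hw : seg 0 (N - 1) ∉ M.accepts := by
    rw [DFA.mem_accepts, hM.accept, Fin.ext_iff, DFA.eval, hstart, hseg 0 (N - 1) (by omega),
      Fin.val_last]
    omega
  rw [hL] at hw
  push Not at hw
  obtain ⟨⟨m, B⟩, hBD, hwB⟩ := hw
  have hm : m < N + 1 := by simpa using (hD _ hBD).1
  have hsub (w : List α) (hw : w ∈ M.accepts) : w ∈ B.accepts := (hL w).1 hw _ hBD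
  obtain ⟨w₀, hw₀⟩ := hM.coaccessible M.start
  -- The state of `B` reached by `w₀` accepts every continuation, so it does not occur on the
  -- rejected run. At most `N - 1` states remain for the `N` prefixes.
  have hsink (x : List α) : w₀ ++ x ∈ B.accepts := by
    apply hsub
    rw [DFA.mem_accepts, DFA.eval, DFA.evalFrom_of_append, (hM.accept _).1 hw₀]
    exact hM.acceptsFrom_last ⊤ trivial
  obtain ⟨i, -, j, -, hij, he⟩ := Finset.exists_ne_map_eq_of_card_lt_of_maps_to
    (s := (Finset.univ : Finset (Fin N))) (t := Finset.univ.erase (B.eval w₀))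
    (f := fun i : Fin N => B.eval (seg 0 i))
    (by rw [Finset.card_erase_of_mem (Finset.mem_univ _), Finset.card_univ, Finset.card_univ,
          Fintype.card_fin, Fintype.card_fin]; omega)
    (fun i _ => by
      refine Finset.mem_coe.2 (Finset.mem_erase.2 ⟨fun hi => hwB ?_, Finset.mem_univ _⟩)
      have := hsink (seg (0 + i) (N - 1 - i))
      rw [DFA.mem_accepts, DFA.eval, DFA.evalFrom_of_append] at this
      have hi' : B.evalFrom B.start (seg 0 i) = B.evalFrom B.start w₀ := hi
      rw [← hi', ← DFA.evalFrom_of_append, ← seg_add, show (i : ℕ) + (N - 1 - i) = N - 1 by omega]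
        at this
      exact this)
  wlog hlt : i < j generalizing i j
  · exact this j i hij.symm he.symm (lt_of_le_of_ne (not_lt.1 hlt) hij.symm)
  rw [Fin.lt_def] at hlt
  have hj := j.isLt
  have hxy : seg 0 j = seg 0 i ++ seg i (j - i) := by
    have := seg_add 0 i (j - i)
    rwa [show (i : ℕ) + (j - i) = j by omega, Nat.zero_add] at this
  have hxyz : seg 0 (N - 1) = seg 0 j ++ seg j (N - 1 - j) := by
    have := seg_add 0 j (N - 1 - j)
    rwa [show (j : ℕ) + (N - 1 - j) = N - 1 by omega, Nat.zero_add] at this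
  -- Repeating the factor between the two prefixes is invisible to `B`. In `M` the second copy
  -- starts at `j > i`, and this lead ends in the accepting state.
  have hB : B.eval (seg 0 j ++ seg i (j - i) ++ seg j (N - 1 - j)) = B.eval (seg 0 (N - 1)) := by
    have he' : B.evalFrom B.start (seg 0 i) = B.evalFrom B.start (seg 0 j) := he
    have hy : B.evalFrom (B.evalFrom B.start (seg 0 i)) (seg i (j - i)) =
        B.evalFrom B.start (seg 0 i) := by
      rw [← DFA.evalFrom_of_append, ← hxy, he']
    simp only [DFA.eval, hxyz, DFA.evalFrom_of_append, ← he', hy]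
  refine hwB ?_
  rw [DFA.mem_accepts]
  simp only
  rw [← hB, ← DFA.mem_accepts]
  apply hsub
  rw [DFA.mem_accepts, hM.accept, DFA.eval, DFA.evalFrom_of_append, DFA.evalFrom_of_append, hstart,
    show M.evalFrom ⟨0, by omega⟩ (seg 0 j) = ⟨j, by omega⟩ from
      Fin.ext (by rw [hseg 0 j (by omega)]; simp)]
  have h1 := hahead i (j - i) (by omega) ⟨j, by omega⟩ hlt
  have h2 := hahead j (N - 1 - j) (by omega) (M.evalFrom ⟨j, by omega⟩ (seg i (j - i))) (by omega)
  rw [← Fin.last_le_iff, Fin.le_def, Fin.val_last]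
  omega

end IsOrdered

end IdealDecomposition

/-! ## Minimal ideal automata -/

namespace IdealDecomposition

variable {α : Type*} {n : ℕ} {M : DFA α (Fin n)}

/-- The left quotients of the language are the languages of the accessible states, and they are the
states of the Myhill–Nerode automaton. Comparing cardinalities then yields both accessibility and
injectivity of `acceptsFrom`. -/
theorem IsMinimal.le_ncard (hM : IsMinimal M) : n ≤ (M.acceptsFrom '' Set.range M.eval).ncard := by
  have hr : Set.range M.accepts.leftQuotient = M.acceptsFrom '' Set.range M.eval := by
    rw [Language.leftQuotient_accepts, Set.range_comp]
  have : Finite (Set.range M.accepts.leftQuotient) := by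
    rw [hr]; exact ((Set.toFinite _).image _).to_subtype
  have := Fintype.ofFinite (Set.range M.accepts.leftQuotient)
  have h := hM _ (DFA.reindex (Fintype.equivFin _) M.accepts.toDFA)
    (by rw [DFA.accepts_reindex, Language.accepts_toDFA])
  rwa [Fintype.card_fin, Fintype.card_eq_nat_card, Nat.card_coe_set_eq, hr] at h

theorem IsMinimal.accessible (hM : IsMinimal M) (q : Fin n) : ∃ w, M.eval w = q := by
  have h := hM.le_ncard.trans (Set.ncard_image_le (Set.toFinite _))
  have : Set.range M.eval = Set.univ :=
    Set.eq_of_subset_of_ncard_le (Set.subset_univ _) (by simpa [Set.ncard_univ] using h)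
  exact Set.range_eq_univ.1 this q

theorem IsMinimal.acceptsFrom_injective (hM : IsMinimal M) :
    Function.Injective M.acceptsFrom := by
  have h := hM.le_ncard
  rw [Set.range_eq_univ.2 hM.accessible] at h
  have := (Set.ncard_image_iff (f := M.acceptsFrom) (s := Set.univ)).1
    (le_antisymm (Set.ncard_image_le (Set.toFinite _)) (by simpa [Set.ncard_univ] using h))
  exact Set.injOn_univ.1 this

theorem IsMinimal.acceptsFrom_le_step (hM : IsMinimal M) (hI : IsIdeal M.accepts) (q : Fin n)
    (a : α) : M.acceptsFrom q ≤ M.acceptsFrom (M.step q a) := by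
  obtain ⟨u, rfl⟩ := hM.accessible q
  intro w hw
  have h1 : u ++ w ∈ M.accepts := by
    rwa [DFA.mem_accepts, DFA.eval, DFA.evalFrom_of_append]
  have h2 := hI (u ++ w) (u ++ a :: w) h1 ((List.Sublist.refl u).append (List.sublist_cons_self a w))
  rwa [DFA.mem_accepts, DFA.eval, DFA.evalFrom_of_append] at h2

theorem IsMinimal.acceptsFrom_lt_step (hM : IsMinimal M) (hI : IsIdeal M.accepts) {q : Fin n}
    {a : α} (h : M.step q a ≠ q) : M.acceptsFrom q < M.acceptsFrom (M.step q a) :=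
  lt_of_le_of_ne (hM.acceptsFrom_le_step hI q a) fun e => h (hM.acceptsFrom_injective e).symm

/-- The rank counts the states with strictly smaller language. It serves to show that topological
sorting never gets stuck. -/
theorem IsMinimal.exists_rank (hM : IsMinimal M) (hI : IsIdeal M.accepts) :
    ∃ ρ : Fin n → ℕ, ∀ q a, M.step q a ≠ q → ρ q < ρ (M.step q a) := by
  classical
  refine ⟨fun q => (Finset.univ.filter fun p => M.acceptsFrom p < M.acceptsFrom q).card,
    fun q a h => Finset.card_lt_card ?_⟩
  have hlt := hM.acceptsFrom_lt_step hI h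
  rw [Finset.ssubset_iff_of_subset]
  · exact ⟨q, by simpa using hlt, by simp⟩
  · intro p hp
    simp only [Finset.mem_filter, Finset.mem_univ, true_and] at hp ⊢
    exact hp.trans hlt

/-- The initial state has the least language, since a word of an ideal stays in it when a prefix is
added. A transition that is no loop enlarges the language strictly, so it cannot end there. -/
theorem IsMinimal.eq_start_of_step (hM : IsMinimal M) (hI : IsIdeal M.accepts) {p : Fin n} {a : α}
    (h : M.step p a = M.start) : p = M.start := by
  by_contra hne
  have hlt := hM.acceptsFrom_lt_step hI (q := p) (a := a) (by rw [h]; exact Ne.symm hne)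
  rw [h] at hlt
  refine hlt.not_ge fun w hw => ?_
  obtain ⟨u, rfl⟩ := hM.accessible p
  have := hI w (u ++ w) hw (List.sublist_append_right u w)
  rwa [DFA.mem_accepts, DFA.eval, DFA.evalFrom_of_append] at this

theorem IsMinimal.exists_pred (hM : IsMinimal M) {q : Fin n} (hq : q ≠ M.start) :
    ∃ p ≠ q, ∃ a, M.step p a = q := by
  obtain ⟨w, rfl⟩ := hM.accessible q
  induction w using List.reverseRecOn with
  | nil => exact absurd rfl hq
  | append_singleton w a ih =>
    rw [DFA.eval_append_singleton] at hq ⊢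
    by_cases h : M.eval w = M.step (M.eval w) a
    · rw [← h] at hq ⊢
      exact ih hq
    · exact ⟨_, h, a, rfl⟩

theorem isIntersectionDecomposition_reindex (e : Fin n ≃ Fin n)
    {D : List ((m : ℕ) × DFA α (Fin m))} :
    IsIntersectionDecomposition (DFA.reindex e M) D ↔ IsIntersectionDecomposition M D := by
  simp [IsIntersectionDecomposition]

theorem hasIntersectionDecomposition_reindex (e : Fin n ≃ Fin n) :
    HasIntersectionDecomposition (DFA.reindex e M) ↔ HasIntersectionDecomposition M :=
  exists_congr fun _ => isIntersectionDecomposition_reindex e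

/-- From an accepting state every word is accepted, so by minimality there is at most one. A word of
the ideal is accepted from every state, in particular from the last, which no run can leave. The
language is nonempty because a single state would suffice for the empty one. -/
theorem IsMinimal.isOrdered {N : ℕ} {M : DFA α (Fin (N + 1))} (hM : IsMinimal M)
    (hI : IsIdeal M.accepts) (hN : 0 < N) (e : Fin (N + 1) ≃ Fin (N + 1)) (h0 : e M.start = 0)
    (he : ∀ q a, e q ≤ e (M.step q a)) : IsOrdered (DFA.reindex e M) := by
  have hstep (q : Fin (N + 1)) (a : α) :
      (DFA.reindex e M).step q a = e (M.step (e.symm q) a) := rfl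
  have hacc (q : Fin (N + 1)) : (DFA.reindex e M).acceptsFrom q = M.acceptsFrom (e.symm q) := by
    ext w
    rw [DFA.mem_acceptsFrom, DFA.evalFrom_reindex, DFA.mem_acceptsFrom]
    exact Iff.of_eq (congrArg (· ∈ M.accept) (e.symm_apply_apply _))
  have hne : ∃ w, w ∈ M.accepts := by
    by_contra hempty
    push Not at hempty
    have := hM 1 ⟨fun _ _ => 0, 0, ∅⟩ (by
      ext w
      exact ⟨fun h => h.elim, fun h => absurd h (hempty w)⟩)
    rw [Fintype.card_fin] at this
    omega
  obtain ⟨w₀, hw₀⟩ := hne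
  have hco (q : Fin (N + 1)) : w₀ ∈ M.acceptsFrom q := by
    obtain ⟨u, rfl⟩ := hM.accessible q
    have := hI w₀ (u ++ w₀) hw₀ (List.sublist_append_right u w₀)
    rwa [DFA.mem_accepts, DFA.eval, DFA.evalFrom_of_append] at this
  have huniq (p q : Fin (N + 1)) (hp : p ∈ M.accept) (hq : q ∈ M.accept) : p = q := by
    have huniv (q : Fin (N + 1)) (hq : q ∈ M.accept) (w : List α) : w ∈ M.acceptsFrom q := by
      obtain ⟨u, rfl⟩ := hM.accessible q
      have := hI u (u ++ w) hq (List.sublist_append_left u w)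
      rwa [DFA.mem_accepts, DFA.eval, DFA.evalFrom_of_append] at this
    apply hM.acceptsFrom_injective
    ext w
    simp [huniv p hp, huniv q hq]
  have hmono (w : List α) : ∀ q, e q ≤ e (M.evalFrom q w) := by
    induction w with
    | nil => exact fun q => le_rfl
    | cons a w ih => exact fun q => (he q a).trans (ih _)
  have hlast : e.symm (Fin.last N) ∈ M.accept := by
    have h1 := hmono w₀ (e.symm (Fin.last N))
    rw [Equiv.apply_symm_apply, Fin.last_le_iff] at h1
    rw [← h1, Equiv.symm_apply_apply]
    exact hco _
  refine ⟨fun q a => ?_, h0, fun q => ?_, fun q hq => ?_, fun q a => ?_, fun q => ⟨w₀, ?_⟩⟩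
  · have := he (e.symm q) a
    rwa [Equiv.apply_symm_apply] at this
  · change e.symm q ∈ M.accept ↔ _
    constructor
    · intro h
      exact e.symm.injective (huniq _ _ h hlast)
    · rintro rfl
      exact hlast
  · obtain ⟨p, hp, a, ha⟩ := hM.exists_pred (q := e.symm q) fun h => hq (by
      rw [← h0, ← h, Equiv.apply_symm_apply])
    refine ⟨e p, lt_of_le_of_ne ?_ ?_, a, ?_⟩
    · have := he p a
      rwa [ha, Equiv.apply_symm_apply] at this
    · exact fun h => hp (by rw [← h, Equiv.symm_apply_apply])
    · rw [hstep, Equiv.symm_apply_apply, ha, Equiv.apply_symm_apply]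
  · rw [hacc, hacc, hstep, Equiv.symm_apply_apply]
    exact hM.acceptsFrom_le_step hI _ a
  · have := hco (e.symm q)
    rwa [← hacc] at this

end IdealDecomposition

/-! ## Topological sorting -/

namespace TopologicalSort

/-- The number of letters `a` with `a₀ ≤ a < k` that lead from `q` to a different state `x`. -/
def edges (d : ℕ → ℕ → ℕ) (k q a₀ x : ℕ) : ℕ :=
  ((Finset.Ico a₀ k).filter fun a => d q a = x ∧ x ≠ q).card

/-- The number of transitions into `x` from another state, in the rows before `q` and among the
first `a` entries of row `q`. -/
def indegree (d : ℕ → ℕ → ℕ) (k q a x : ℕ) : ℕ :=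
  ∑ p ∈ Finset.range q, edges d k p 0 x + edges d a q 0 x

/-- The number of transitions into `x` from another state that have not been processed when `h`
states of the list `ord` and `a` letters of the following state have been processed. -/
def inflow (d : ℕ → ℕ → ℕ) (n k : ℕ) (ord : ℕ → ℕ) (h a x : ℕ) : ℕ :=
  ∑ q ∈ (Finset.range n).filter (fun q => ∀ i < h, ord i ≠ q),
    edges d k q (if q = ord h then a else 0) x

variable {d : ℕ → ℕ → ℕ} {n k : ℕ}

theorem edges_le {q a x : ℕ} : edges d k q a x ≤ k - a :=
  (Finset.card_filter_le _ _).trans (by simp)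

theorem edges_self {q x : ℕ} : edges d k q k x = 0 := by simp [edges]

theorem edges_succ_left {q a x : ℕ} (ha : a < k) :
    edges d k q a x = edges d k q (a + 1) x + if d q a = x ∧ x ≠ q then 1 else 0 := by
  have : Finset.Ico a k = insert a (Finset.Ico (a + 1) k) := by
    ext; simp; omega
  rw [edges, edges, this, Finset.filter_insert]
  split
  · rw [Finset.card_insert_of_notMem (by simp)]
  · rfl

theorem edges_succ_right {q a x : ℕ} :
    edges d (a + 1) q 0 x = edges d a q 0 x + if d q a = x ∧ x ≠ q then 1 else 0 := by
  have : Finset.Ico 0 (a + 1) = insert a (Finset.Ico 0 a) := by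
    ext; simp; omega
  rw [edges, edges, this, Finset.filter_insert]
  split
  · rw [Finset.card_insert_of_notMem (by simp)]
  · rfl

theorem edges_pos {q a b x : ℕ} (hab : a ≤ b) (hb : b < k) (h : d q b = x) (hx : x ≠ q) :
    0 < edges d k q a x :=
  Finset.card_pos.2 ⟨b, by simp [hab, hb, h, hx]⟩

theorem exists_of_edges_ne_zero {q a x : ℕ} (h : edges d k q a x ≠ 0) :
    ∃ b < k, d q b = x ∧ x ≠ q := by
  obtain ⟨b, hb⟩ := Finset.card_ne_zero.1 h
  simp only [Finset.mem_filter, Finset.mem_Ico] at hb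
  exact ⟨b, hb.1.2, hb.2⟩

theorem indegree_zero {x : ℕ} : indegree d k 0 0 x = 0 := by simp [indegree, edges]

theorem indegree_succ {q a x : ℕ} :
    indegree d k q (a + 1) x = indegree d k q a x + if d q a = x ∧ x ≠ q then 1 else 0 := by
  rw [indegree, indegree, edges_succ_right, Nat.add_assoc]

theorem indegree_next {q x : ℕ} : indegree d k q k x = indegree d k (q + 1) 0 x := by
  rw [indegree, indegree, Finset.sum_range_succ, edges_self, Nat.add_zero]

theorem indegree_le {q a x : ℕ} : indegree d k q a x ≤ q * k + a := by
  refine add_le_add ((Finset.sum_le_card_nsmul _ _ k fun p _ => ?_).trans (by simp)) ?_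
  · exact edges_le
  · exact edges_le

theorem inflow_zero {ord : ℕ → ℕ} {x : ℕ} : inflow d n k ord 0 0 x = indegree d k n 0 x := by
  simp [inflow, indegree, edges_self]

theorem inflow_congr {ord ord' : ℕ → ℕ} {h a x : ℕ} (he : ∀ i ≤ h, ord i = ord' i) :
    inflow d n k ord h a x = inflow d n k ord' h a x := by
  have h1 : ∀ q, (∀ i < h, ord i ≠ q) ↔ ∀ i < h, ord' i ≠ q := fun q =>
    forall₂_congr fun i hi => by rw [he i hi.le]
  simp only [inflow, h1, he h le_rfl]

theorem inflow_succ {ord : ℕ → ℕ} {h a x : ℕ} (ha : a < k) (hn : ord h < n)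
    (hinj : ∀ i < h, ord i ≠ ord h) :
    inflow d n k ord h a x =
      inflow d n k ord h (a + 1) x + if d (ord h) a = x ∧ x ≠ ord h then 1 else 0 := by
  have hmem : ord h ∈ (Finset.range n).filter (fun q => ∀ i < h, ord i ≠ q) := by
    simpa [hn] using hinj
  rw [inflow, inflow, ← Finset.add_sum_erase _ _ hmem, ← Finset.add_sum_erase _ _ hmem,
    if_pos rfl, if_pos rfl, edges_succ_left ha]
  have : ∀ b, ∑ q ∈ ((Finset.range n).filter (fun q => ∀ i < h, ord i ≠ q)).erase (ord h),
      edges d k q (if q = ord h then b else 0) x =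
      ∑ q ∈ ((Finset.range n).filter (fun q => ∀ i < h, ord i ≠ q)).erase (ord h),
      edges d k q 0 x := fun b => Finset.sum_congr rfl fun q hq => by
    rw [if_neg (Finset.ne_of_mem_erase hq)]
  rw [this, this]
  omega

theorem inflow_next {ord : ℕ → ℕ} {h x : ℕ} (hn : ord h < n)
    (hinj : ∀ i < h, ord i ≠ ord h) :
    inflow d n k ord h k x = inflow d n k ord (h + 1) 0 x := by
  have hmem : ord h ∈ (Finset.range n).filter (fun q => ∀ i < h, ord i ≠ q) := by
    simpa [hn] using hinj
  rw [inflow, inflow, ← Finset.add_sum_erase _ _ hmem, if_pos rfl, edges_self, Nat.zero_add]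
  refine Finset.sum_congr ?_ fun q hq => ?_
  · ext q
    simp only [Finset.mem_erase, Finset.mem_filter, Finset.mem_range, Nat.lt_succ_iff_lt_or_eq]
    constructor
    · rintro ⟨h1, h2, h3⟩
      refine ⟨h2, ?_⟩
      rintro i (hi | rfl)
      exacts [h3 i hi, h1.symm]
    · rintro ⟨h1, h2⟩
      exact ⟨(h2 h (.inr rfl)).symm, h1, fun i hi => h2 i (.inl hi)⟩
  · have : q ≠ ord h := by
      rintro rfl
      simp at hq
      exact hq.2 h le_rfl rfl
    simp [this]

/-- The invariant of topological sorting: `ord` lists `t` states with positions `pos`, the states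
listed before position `h` and `a` letters of the state at position `h` have been processed, and
`cnt` counts the transitions that are still to be processed. -/
structure Inv (d : ℕ → ℕ → ℕ) (n k s : ℕ) (cnt ord pos : ℕ → ℕ) (t h a : ℕ) : Prop where
  ord_zero : ord 0 = s
  pos_zero : pos s = 0
  t_pos : 0 < t
  ord_lt : ∀ i < t, ord i < n
  pos_ord : ∀ i < t, pos (ord i) = i
  cnt_eq : ∀ x < n, cnt x = inflow d n k ord h a x
  cnt_zero : ∀ x < n, cnt x = 0 ↔ ∃ i < t, ord i = x
  pred : ∀ j < t, ∀ q < n, ∀ a < k, d q a = ord j → q ≠ ord j → ∃ i < j, ord i = q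

variable {s t h a : ℕ} {cnt ord pos : ℕ → ℕ}

theorem Inv.inj (H : Inv d n k s cnt ord pos t h a) {i j : ℕ} (hi : i < t) (hj : j < t)
    (e : ord i = ord j) : i = j := by
  rw [← H.pos_ord i hi, ← H.pos_ord j hj, e]

theorem Inv.le (H : Inv d n k s cnt ord pos t h a) : t ≤ n := by
  have := Finset.card_le_card_of_injOn (s := Finset.range t) (t := Finset.range n) ord
    (fun i hi => by simpa using H.ord_lt i (by simpa using hi))
    (fun i hi j hj e => H.inj (by simpa using hi) (by simpa using hj) e)
  simpa using this

/-- The initial state is the only one without transitions from other states, so it is the only one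
whose counter is zero. A constant `pos` will do because only listed states need correct positions.
-/
theorem Inv.init (hs : s < n) (hsrc : ∀ q < n, ∀ a < k, d q a = s → q = s)
    (hpred : ∀ x < n, x ≠ s → ∃ q < n, q ≠ x ∧ ∃ a < k, d q a = x)
    (hcnt : ∀ x < n, cnt x = indegree d k n 0 x) :
    Inv d n k s cnt (Function.update (fun _ => 0) 0 s) (fun _ => 0) 1 0 0 where
  ord_zero := by simp
  pos_zero := rfl
  t_pos := by omega
  ord_lt i hi := by
    obtain rfl : i = 0 := by omega
    simpa using hs
  pos_ord i hi := by omega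
  cnt_eq x hx := by rw [hcnt x hx, inflow_zero]
  cnt_zero x hx := by
    have h1 : (∃ i < 1, Function.update (fun _ => 0) 0 s i = x) ↔ s = x := by simp
    rw [h1, hcnt x hx, indegree, edges_self, Nat.add_zero, Finset.sum_eq_zero_iff]
    constructor
    · intro h0
      by_contra hne
      obtain ⟨q, hq, hqx, a, ha, hd⟩ := hpred x hx (Ne.symm hne)
      exact (edges_pos (Nat.zero_le a) ha hd hqx.symm).ne' (h0 q (by simpa using hq))
    · rintro rfl q hq
      by_contra h0
      obtain ⟨b, hb, hd, hne⟩ := exists_of_edges_ne_zero h0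
      exact hne (hsrc q (by simpa using hq) b hb hd).symm
  pred j hj q hq a ha hd hne := by
    obtain rfl : j = 0 := by omega
    simp only [Function.update_self] at hd hne
    exact absurd (hsrc q hq a ha hd) hne

theorem Inv.step_loop (H : Inv d n k s cnt ord pos t h a) (ht : h < t) (ha : a < k)
    (hd : d (ord h) a = ord h) : Inv d n k s cnt ord pos t h (a + 1) :=
  { H with
    cnt_eq := fun x hx => by
      rw [H.cnt_eq x hx, inflow_succ ha (H.ord_lt h ht)
        (fun i hi e => hi.ne (H.inj (hi.trans ht) ht e)),
        if_neg (fun h => h.2 (h.1.symm.trans hd)), Nat.add_zero] }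

theorem Inv.cnt_pos (H : Inv d n k s cnt ord pos t h a) (ht : h < t) (ha : a < k) {x : ℕ}
    (hx : x < n) (hd : d (ord h) a = x) (hne : x ≠ ord h) : 0 < cnt x := by
  rw [H.cnt_eq x hx, inflow_succ ha (H.ord_lt h ht)
    (fun i hi e => hi.ne (H.inj (hi.trans ht) ht e)), if_pos ⟨hd, hne⟩]
  omega

theorem Inv.cnt_update (H : Inv d n k s cnt ord pos t h a) (ht : h < t) (ha : a < k) {x : ℕ}
    (hd : d (ord h) a = x) (hne : x ≠ ord h) :
    ∀ y < n, Function.update cnt x (cnt x - 1) y = inflow d n k ord h (a + 1) y := by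
  intro y hy
  have h1 := H.cnt_eq y hy
  rw [inflow_succ ha (H.ord_lt h ht) (fun i hi e => hi.ne (H.inj (hi.trans ht) ht e))] at h1
  rw [Function.update_apply]
  split
  · rename_i e
    subst e
    rw [if_pos ⟨hd, hne⟩] at h1
    omega
  · rename_i e
    rw [if_neg fun h' => e (h'.1.symm.trans hd)] at h1
    exact h1

theorem Inv.step_dec (H : Inv d n k s cnt ord pos t h a) (ht : h < t) (ha : a < k) {x : ℕ}
    (hx : x < n) (hd : d (ord h) a = x) (hne : x ≠ ord h) (hc : cnt x - 1 ≠ 0) :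
    Inv d n k s (Function.update cnt x (cnt x - 1)) ord pos t h (a + 1) :=
  { H with
    cnt_eq := H.cnt_update ht ha hd hne
    cnt_zero := fun y hy => by
      rw [← H.cnt_zero y hy, Function.update_apply]
      split
      · rename_i e
        subst e
        omega
      · rfl }

theorem Inv.step_push (H : Inv d n k s cnt ord pos t h a) (ht : h < t) (ha : a < k) {x : ℕ}
    (hx : x < n) (hd : d (ord h) a = x) (hne : x ≠ ord h) (hc : cnt x - 1 = 0) :
    Inv d n k s (Function.update cnt x (cnt x - 1)) (Function.update ord t x)
      (Function.update pos x t) (t + 1) h (a + 1) := by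
  have hpos := H.cnt_pos ht ha hx hd hne
  have hnew (i : ℕ) (hi : i < t) : ord i ≠ x := fun e =>
    hpos.ne' ((H.cnt_zero x hx).2 ⟨i, hi, e⟩)
  have hord (i : ℕ) (hi : i < t) : Function.update ord t x i = ord i :=
    Function.update_of_ne hi.ne _ _
  have hcnt := H.cnt_update ht ha hd hne
  refine ⟨by rw [hord 0 H.t_pos, H.ord_zero], ?_, by omega, ?_, ?_, ?_, ?_, ?_⟩
  · rw [Function.update_of_ne (fun e => hnew 0 H.t_pos (H.ord_zero.trans e)), H.pos_zero]
  · intro i hi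
    rcases Nat.lt_succ_iff_lt_or_eq.1 hi with hi | rfl
    · rw [hord i hi]; exact H.ord_lt i hi
    · simpa using hx
  · intro i hi
    rcases Nat.lt_succ_iff_lt_or_eq.1 hi with hi | rfl
    · rw [hord i hi, Function.update_of_ne (hnew i hi)]; exact H.pos_ord i hi
    · simp
  · intro y hy
    rw [hcnt y hy]
    exact inflow_congr fun i hi => (hord i (by omega)).symm
  · intro y hy
    by_cases e : y = x
    · subst e
      simp only [Function.update_self, hc, true_iff]
      exact ⟨t, by omega, by simp⟩
    · rw [Function.update_of_ne e, H.cnt_zero y hy]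
      constructor
      · rintro ⟨i, hi, rfl⟩
        exact ⟨i, by omega, hord i hi⟩
      · rintro ⟨i, hi, hi'⟩
        rcases Nat.lt_succ_iff_lt_or_eq.1 hi with hi | rfl
        · exact ⟨i, hi, by rw [← hi', hord i hi]⟩
        · simp only [Function.update_self] at hi'
          exact absurd hi'.symm e
  · intro j hj q hq b hb hdq hqj
    rcases Nat.lt_succ_iff_lt_or_eq.1 hj with hj | rfl
    · rw [hord j hj] at hdq hqj
      obtain ⟨i, hi, rfl⟩ := H.pred j hj q hq b hb hdq hqj
      exact ⟨i, hi, hord i (by omega)⟩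
    · simp only [Function.update_self] at hdq hqj
      by_contra hno
      push Not at hno
      -- The counter of `x` has dropped to zero, so no unprocessed transition enters `x`; one from
      -- an unlisted state would still be unprocessed.
      have h0 : inflow d n k ord h (a + 1) x = 0 := by
        rw [← hcnt x hx, Function.update_self, hc]
      rw [inflow, Finset.sum_eq_zero_iff] at h0
      have hqh (i : ℕ) (hi : i ≤ h) : ord i ≠ q := by
        rw [← hord i (by omega)]
        exact hno i (by omega)
      have := h0 q (by simpa [hq] using fun i hi => hqh i (le_of_lt hi))
      rw [if_neg (hqh h le_rfl).symm] at this
      exact (edges_pos (Nat.zero_le b) hb hdq hqj.symm).ne' this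

theorem Inv.next (H : Inv d n k s cnt ord pos t h k) (ht : h < t) :
    Inv d n k s cnt ord pos t (h + 1) 0 :=
  { H with
    cnt_eq := fun x hx => by
      rw [H.cnt_eq x hx, inflow_next (H.ord_lt h ht)
        (fun i hi e => hi.ne (H.inj (hi.trans ht) ht e))] }

/-- If all listed states were processed too early, take an unlisted state of least rank. Its counter
is positive, so a transition enters it from an unprocessed, hence unlisted, state of smaller rank.
-/
theorem Inv.lt (H : Inv d n k s cnt ord pos t h 0) (hn : h < n) (ρ : ℕ → ℕ)
    (hρ : ∀ q < n, ∀ a < k, d q a ≠ q → ρ q < ρ (d q a)) : h < t := by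
  by_contra hth
  push Not at hth
  have hU : ((Finset.range n).filter fun x => ∀ i < t, ord i ≠ x).Nonempty := by
    by_contra hU
    rw [Finset.not_nonempty_iff_eq_empty, Finset.filter_eq_empty_iff] at hU
    have : Finset.range n ⊆ (Finset.range t).image ord := by
      intro x hx
      have := hU hx
      push Not at this
      simpa using this
    have := (Finset.card_le_card this).trans Finset.card_image_le
    simp only [Finset.card_range] at this
    omega
  obtain ⟨x, hx, hmin⟩ := Finset.exists_min_image _ ρ hU
  simp only [Finset.mem_filter, Finset.mem_range] at hx hmin
  have hc : cnt x ≠ 0 := fun h0 => by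
    obtain ⟨i, hi, e⟩ := (H.cnt_zero x hx.1).1 h0
    exact hx.2 i hi e
  rw [H.cnt_eq x hx.1, inflow] at hc
  obtain ⟨q, hq, he⟩ := Finset.exists_ne_zero_of_sum_ne_zero hc
  simp only [Finset.mem_filter, Finset.mem_range] at hq
  obtain ⟨b, hb, hd, hne⟩ := exists_of_edges_ne_zero he
  have h1 := hρ q hq.1 b hb (by rw [hd]; exact hne)
  have h2 := hmin q ⟨hq.1, fun i hi => hq.2 i (by omega)⟩
  rw [hd] at h1
  omega

end TopologicalSort

/-! ## Verification conditions for structured programs -/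

namespace RAM

@[simp] theorem St.set_v (σ : St) (x y : Var) (m : ℕ) :
    (σ.set x m).v y = if y = x then m else σ.v y := Function.update_apply ..

@[simp] theorem St.set_arr (σ : St) (x : Var) (m : ℕ) : (σ.set x m).arr = σ.arr := rfl

@[simp] theorem St.set_inp (σ : St) (x : Var) (m : ℕ) : (σ.set x m).inp = σ.inp := rfl

@[simp] theorem St.set_out (σ : St) (x : Var) (m : ℕ) : (σ.set x m).out = σ.out := rfl

@[simp] theorem St.setArr_v (σ : St) (A : Arr) (i m : ℕ) : (σ.setArr A i m).v = σ.v := rfl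

@[simp] theorem St.setArr_arr (σ : St) (A B : Arr) (i m : ℕ) :
    (σ.setArr A i m).arr B = if B = A then Function.update (σ.arr A) i m else σ.arr B :=
  Function.update_apply ..

@[simp] theorem St.setArr_inp (σ : St) (A : Arr) (i m : ℕ) : (σ.setArr A i m).inp = σ.inp := rfl

@[simp] theorem St.setArr_out (σ : St) (A : Arr) (i m : ℕ) : (σ.setArr A i m).out = σ.out := rfl

/-- Started in `σ`, the program `c` creates no numbers greater than `V` and ends in a state that
satisfies `Q`. -/
def wp (V : ℕ) (c : Cmd) (Q : St → Prop) (σ : St) : Prop :=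
  c.Safe V σ ∧ Q (c.eval σ)

variable {V : ℕ} {Q : St → Prop} {σ : St}

theorem wp_skip : wp V .skip Q σ ↔ Q σ := by simp [wp, Cmd.Safe, Cmd.eval]

theorem wp_op {o : Op} : wp V (.op o) Q σ ↔ o.Safe V σ ∧ Q (o.eval σ) := Iff.rfl

theorem wp_seq {c d : Cmd} : wp V (.seq c d) Q σ ↔ wp V c (wp V d Q) σ := and_assoc

theorem wp_ite {b : Test} {c d : Cmd} :
    wp V (.ite b c d) Q σ ↔ (b.Holds σ → wp V c Q σ) ∧ (¬ b.Holds σ → wp V d Q σ) := by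
  by_cases h : b.Holds σ <;> simp [wp, Cmd.Safe, Cmd.eval, h]

/-- The frame is supplied to every round, so invariants mention only what the loop changes. -/
theorem wp_loop {x y : Var} {c : Cmd} (I : ℕ → St → Prop) (h0 : I 0 (σ.set x 0))
    (hI : ∀ j < σ.v y, ∀ τ, (Cmd.loop x y c).Frame σ τ → τ.v x = j → I j τ →
      wp V c (fun τ' => I (j + 1) (τ'.set x (j + 1))) τ)
    (hQ : ∀ τ, (Cmd.loop x y c).Frame σ τ → I (σ.v y) τ → Q τ) : wp V (.loop x y c) Q σ := by
  have hvx : ∀ j, (loopIter c.eval x σ j).v x = j := by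
    intro j; cases j <;> simp [loopIter]
  have key (j : ℕ) (hj : j ≤ σ.v y) : I j (loopIter c.eval x σ j) := by
    induction j with
    | zero => exact h0
    | succ j ih =>
      exact (hI j hj _ (frame_loopIter c.frame x y σ j) (hvx j) (ih (by omega))).2
  exact ⟨fun j hj => (hI j hj _ (frame_loopIter c.frame x y σ j) (hvx j) (key j hj.le)).1,
    hQ _ (frame_loopIter c.frame x y σ _) (key _ le_rfl)⟩

theorem wp_mono {c : Cmd} {Q' : St → Prop} (h : wp V c Q σ)
    (hQ : ∀ τ, c.Frame σ τ → Q τ → Q' τ) : wp V c Q' σ :=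
  ⟨h.1, hQ _ (c.frame σ) h.2⟩

end RAM

/-! ## The encoding of automata -/

namespace IdealDecomposition

/-- The transition table of an automaton as a function on natural numbers. -/
def stepFun {n k : ℕ} (M : DFA (Fin k) (Fin n)) (q a : ℕ) : ℕ :=
  if h : q < n ∧ a < k then M.step ⟨q, h.1⟩ ⟨a, h.2⟩ else 0

theorem stepFun_eq {n k : ℕ} (M : DFA (Fin k) (Fin n)) (q : Fin n) (a : Fin k) :
    stepFun M q a = M.step q a := by
  simp [stepFun]

theorem stepFun_lt {n k : ℕ} (M : DFA (Fin k) (Fin n)) {q : ℕ} (a : ℕ) (hq : q < n) :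
    stepFun M q a < n := by
  unfold stepFun
  split
  · exact Fin.isLt _
  · omega

theorem mul_add_lt {q n a k : ℕ} (hq : q < n) (ha : a < k) : q * k + a < n * k := by
  have : (q + 1) * k ≤ n * k := Nat.mul_le_mul_right k hq
  rw [Nat.add_mul] at this
  omega

theorem ofFn_val {β : Type*} (n : ℕ) (g : ℕ → β) :
    (List.ofFn fun i : Fin n => g i) = (List.range n).map g := by
  rw [List.ofFn_eq_map, ← List.map_coe_finRange_eq_range, List.map_map]
  rfl

/-- Three header entries and `n` acceptance bits precede the table; its entry `m` lies in row `m /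
k` and column `m % k`. -/
theorem getD_encodeDFA {n k : ℕ} (M : DFA (Fin k) (Fin n)) {q a : ℕ} (hq : q < n) (ha : a < k) :
    (encodeDFA M).getD (3 + n + (q * k + a)) 0 = stepFun M q a := by
  have h : (List.ofFn fun q : Fin n => List.ofFn fun a : Fin k => (M.step q a : ℕ)).flatten =
      List.ofFn fun m : Fin (n * k) => stepFun M (m / k) (m % k) := by
    rw [List.ofFn_mul]
    congr 2
    funext q
    congr 1
    funext a
    have hk : 0 < k := by have := a.isLt; omega
    rw [← stepFun_eq]
    simp only
    rw [Nat.add_comm, Nat.add_mul_div_right _ _ hk, Nat.add_mul_mod_self_right,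
      Nat.div_eq_of_lt a.isLt, Nat.mod_eq_of_lt a.isLt, Nat.zero_add]
  have hlt := mul_add_lt hq ha
  have hk : 0 < k := by omega
  rw [encodeDFA, h, List.getD_append_right _ _ _ _ (by simp; omega),
    List.getD_eq_getElem _ _ (by simpa using by omega), List.getElem_ofFn]
  simp only [List.length_append, List.length_cons, List.length_nil, List.length_ofFn]
  rw [show 3 + n + (q * k + a) - (0 + 1 + 1 + 1 + n) = a + q * k by omega,
    Nat.add_mul_div_right _ _ hk, Nat.add_mul_mod_self_right, Nat.div_eq_of_lt ha,
    Nat.mod_eq_of_lt ha, Nat.zero_add]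

theorem le_of_mem_encodeDFA {n k : ℕ} (M : DFA (Fin k) (Fin n)) {m : ℕ}
    (hm : m ∈ encodeDFA M) : m ≤ n + k := by
  have := M.start.isLt
  simp only [encodeDFA, List.mem_append, List.mem_cons, List.not_mem_nil, or_false,
    List.mem_flatten, List.mem_ofFn'] at hm
  rcases hm with ((rfl | rfl | rfl) | ⟨q, rfl⟩) | ⟨l, ⟨q, rfl⟩, h⟩
  · omega
  · omega
  · omega
  · simp only
    split <;> omega
  · rw [List.mem_ofFn'] at h
    obtain ⟨a, rfl⟩ := h
    have := (M.step q a).isLt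
    simp only
    omega

theorem encodeDFA_eq_cons {n k : ℕ} (M : DFA (Fin k) (Fin n)) :
    encodeDFA M = n :: k :: (M.start : ℕ) :: (encodeDFA M).drop 3 := rfl

end IdealDecomposition

/-! ## The decision algorithm -/

namespace IdealDecomposition

open RAM

local infixr:60 " ;; " => Cmd.seq

local prefix:max "↟" => Cmd.op

/-- Read the number of states, the number of letters, and the initial state. -/
def readHeader : Cmd :=
  ↟(.set .one 1) ;; ↟(.read .size) ;; ↟(.read .letters) ;; ↟(.read .start) ;;
  ↟(.sub .size1 .size .one) ;; ↟(.sub .size2 .size1 .one)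

/-- Read the transition table, and count the transitions into each state. -/
def readTable : Cmd :=
  .loop .idx .size ↟(.read .val) ;;
  ↟(.set .ptr 0) ;;
  .loop .idx .size (
    ↟(.put .row .idx .ptr) ;;
    .loop .sym .letters (
      ↟(.read .dest) ;;
      ↟(.put .table .ptr .dest) ;;
      .ite (.ne .idx .dest)
        (↟(.get .val .cnt .dest) ;; ↟(.inc .val) ;; ↟(.put .cnt .dest .val))
        .skip ;;
      ↟(.inc .ptr)))

/-- Sort the states topologically. -/
def sortStates : Cmd :=
  ↟(.put .ord .zero .start) ;;
  ↟(.set .tail 1) ;;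
  .loop .idx .size (
    ↟(.get .state .ord .idx) ;;
    ↟(.get .ptr .row .state) ;;
    .loop .sym .letters (
      ↟(.get .dest .table .ptr) ;;
      ↟(.inc .ptr) ;;
      .ite (.ne .state .dest)
        (↟(.get .val .cnt .dest) ;; ↟(.sub .val .val .one) ;; ↟(.put .cnt .dest .val) ;;
          .ite (.lt .val .one)
            (↟(.put .ord .tail .dest) ;; ↟(.put .pos .dest .tail) ;; ↟(.inc .tail))
            .skip)
        .skip))

/-- Compute the transition table for the states numbered in topological order. -/
def renumberStates : Cmd :=
  ↟(.set .ptr2 0) ;;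
  .loop .idx .size (
    ↟(.get .state .ord .idx) ;;
    ↟(.get .ptr .row .state) ;;
    .loop .sym .letters (
      ↟(.get .dest .table .ptr) ;;
      ↟(.get .val .pos .dest) ;;
      ↟(.put .sorted .ptr2 .val) ;;
      ↟(.inc .ptr) ;;
      ↟(.inc .ptr2)))

/-- Determine whether state `idx` has an edge and a gap. -/
def testState : Cmd :=
  ↟(.add .idx1 .idx .one) ;;
  ↟(.set .hasEdge 0) ;;
  ↟(.set .hasGap 0) ;;
  .loop .sym .letters (
    ↟(.get .dest .sorted .ptr) ;;
    ↟(.get .val .sorted .ptr2) ;;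
    ↟(.inc .ptr) ;;
    ↟(.inc .ptr2) ;;
    .ite (.ne .dest .idx1)
      (.ite (.ne .dest .idx) .skip (.ite (.ne .val .idx1) ↟(.set .hasGap 1) .skip))
      (↟(.set .hasEdge 1) ;; .ite (.ne .val .idx1) ↟(.set .hasGap 1) .skip))

/-- Find the last state that lacks an edge or a gap. -/
def findState : Cmd :=
  ↟(.set .found 0) ;;
  ↟(.set .ptr 0) ;;
  ↟(.copy .ptr2 .letters) ;;
  .loop .idx .size2 (
    testState ;;
    .ite (.lt .hasEdge .one)
      (↟(.copy .found .idx1) ;; ↟(.copy .target .size2))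
      (.ite (.lt .hasGap .one)
        (↟(.copy .found .idx1) ;; ↟(.copy .target .idx))
        .skip))

/-- Print whether a state has been found. -/
def printDecision : Cmd :=
  ↟(.sub .val .one .found) ;; ↟(.sub .val .one .val) ;; ↟(.print .val)

/-- Print the automaton without state `cut`, whose incoming transitions are redirected to the state
that has number `target` afterwards. -/
def printAutomaton : Cmd :=
  ↟(.print .size1) ;; ↟(.print .letters) ;; ↟(.print .zero) ;;
  .loop .idx .size2 ↟(.print .zero) ;;
  ↟(.print .one) ;;
  ↟(.set .ptr 0) ;;
  .loop .idx .size1 (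
    .ite (.ne .idx .cut) .skip ↟(.add .ptr .ptr .letters) ;;
    .loop .sym .letters (
      ↟(.get .val .sorted .ptr) ;;
      ↟(.inc .ptr) ;;
      .ite (.lt .val .cut) ↟(.print .val)
        (.ite (.lt .cut .val) (↟(.sub .val .val .one) ;; ↟(.print .val)) ↟(.print .target))))

/-- Print the two automata of the decomposition. -/
def printDecomposition : Cmd :=
  ↟(.set .val 2) ;; ↟(.print .val) ;; ↟(.sub .cut .found .one) ;; printAutomaton ;;
  ↟(.copy .target .found) ;; ↟(.copy .cut .found) ;; printAutomaton

/-- The common part of both algorithms. -/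
def analyze : Cmd := readTable ;; sortStates ;; renumberStates ;; findState

/-- The values of the variables that do not change after the header has been read. -/
structure Header (n k s : ℕ) (σ : St) : Prop where
  one : σ.v .one = 1
  zero : σ.v .zero = 0
  size : σ.v .size = n
  letters : σ.v .letters = k
  start : σ.v .start = s
  size1 : σ.v .size1 = n - 1
  size2 : σ.v .size2 = n - 2

/-- The variables of `Header` are not changed by `c`. -/
def KeepsHeader (c : Cmd) : Prop :=
  ∀ x ∈ [Var.one, .zero, .size, .letters, .start, .size1, .size2], x ∉ c.writes

instance (c : Cmd) : Decidable (KeepsHeader c) := by unfold KeepsHeader; infer_instance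

theorem Header.frame {n k s : ℕ} {σ τ : St} {c : Cmd} (h : Header n k s σ) (hf : c.Frame σ τ)
    (hc : KeepsHeader c) : Header n k s τ where
  one := (hf.v _ (hc _ (by simp))).trans h.one
  zero := (hf.v _ (hc _ (by simp))).trans h.zero
  size := (hf.v _ (hc _ (by simp))).trans h.size
  letters := (hf.v _ (hc _ (by simp))).trans h.letters
  start := (hf.v _ (hc _ (by simp))).trans h.start
  size1 := (hf.v _ (hc _ (by simp))).trans h.size1
  size2 := (hf.v _ (hc _ (by simp))).trans h.size2

theorem headD_drop (l : List ℕ) (m : ℕ) : (l.drop m).headD 0 = l.getD m 0 := by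
  rw [List.headD_eq_head?_getD, List.head?_drop, List.getD_eq_getElem?_getD]

variable {n k s V : ℕ} {d : ℕ → ℕ → ℕ} {x : List ℕ}
  {X : ℕ → ℕ}

/-- The table and the counters after the input has been read. -/
structure TableRead (n k : ℕ) (d : ℕ → ℕ → ℕ) (X : ℕ → ℕ) (σ : St) : Prop where
  row : ∀ q < n, σ.arr .row q = q * k
  table : ∀ m < n * k, σ.arr .table m = X m
  cnt : ∀ y, σ.arr .cnt y = TopologicalSort.indegree d k n 0 y

theorem wp_readTable {σ : St} (hσ : Header n k s σ) (hV : n * k + n + k + 3 ≤ V)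
    (hx : σ.inp = x.drop 3) (hX : ∀ m, x.getD (3 + n + m) 0 = X m)
    (hd : ∀ q < n, ∀ a < k, X (q * k + a) = d q a)
    (hcnt : ∀ y, σ.arr .cnt y = 0) :
    wp V readTable (TableRead n k d X) σ := by
  unfold readTable
  rw [wp_seq]
  -- The acceptance bits are read and discarded: in the sorted automaton the accepting state is
  -- known to be the last.
  refine wp_loop (fun j τ => τ.inp = x.drop (3 + j)) (by simpa using hx) ?_ ?_
  · intro j hj τ hf hτ hI
    simp [wp_op, Op.Safe, Op.eval, hI, List.tail_drop, Nat.add_assoc]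
  intro τ₁ hf₁ hI₁
  have hτ₁ := hσ.frame hf₁ (by decide)
  rw [hσ.size] at hI₁
  rw [wp_seq, wp_op]
  refine ⟨Nat.zero_le _, ?_⟩
  refine wp_loop (fun j τ => τ.v .ptr = j * k ∧ τ.inp = x.drop (3 + n + j * k) ∧
    (∀ q < j, τ.arr .row q = q * k) ∧
    (∀ m < j * k, τ.arr .table m = X m) ∧
    ∀ y, τ.arr .cnt y = TopologicalSort.indegree d k j 0 y) ?_ ?_ ?_
  · refine ⟨by simp [Op.eval], by simpa [Op.eval] using hI₁, by simp, by simp, fun y => ?_⟩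
    rw [TopologicalSort.indegree_zero, ← hcnt y, ← hf₁.arr .cnt (by decide)]
    rfl
  · rintro j hj τ hf hτj ⟨hptr, hinp, hrow, htab, hc⟩
    have hτ := (hτ₁.frame (Op.frame (.set .ptr 0) _) (by decide)).frame hf (by decide)
    replace hj : j < n := hτ₁.size ▸ hj
    have hjk : j * k + k ≤ n * k := by
      have := Nat.mul_le_mul_right k hj
      rwa [Nat.succ_mul] at this
    rw [wp_seq, wp_op]
    refine ⟨trivial, ?_⟩
    have hτ' := hτ.frame (Op.frame (.put .row .idx .ptr) _) (by decide)
    refine wp_loop (fun a ω => ω.v .ptr = j * k + a ∧ ω.inp = x.drop (3 + n + (j * k + a)) ∧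
      (∀ m < j * k + a, ω.arr .table m = X m) ∧
      ∀ y, ω.arr .cnt y = TopologicalSort.indegree d k j a y) ?_ ?_ ?_
    · simpa [Op.eval, hptr, hinp] using ⟨htab, hc⟩
    · rintro a ha ω hf' hωa ⟨hptr', hinp', htab', hc'⟩
      replace ha : a < k := hτ'.letters ▸ ha
      have hω := hτ'.frame hf' (by decide)
      have hidx : ω.v .idx = j := by
        rw [hf'.v .idx (by decide)]
        simpa [Op.eval] using hτj
      have hlt := mul_add_lt hj ha
      have hread : ω.inp.headD 0 = d j a := by
        rw [hinp', headD_drop, hX, hd j hj a ha]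
      have htail : ω.inp.tail = x.drop (3 + n + (j * k + (a + 1))) := by
        rw [hinp', List.tail_drop]; rfl
      -- A counter is at most the number of table entries read so far, which keeps it within `V`.
      have hle : TopologicalSort.indegree d k j a (d j a) ≤ j * k + a :=
        TopologicalSort.indegree_le
      have htab'' (m : ℕ) (hm : m < j * k + (a + 1)) :
          Function.update (ω.arr .table) (j * k + a) (d j a) m = X m := by
        rw [Function.update_apply]
        split
        · rename_i e
          rw [e, hd j hj a ha]
        · exact htab' m (by omega)
      by_cases hne : j = d j a
      · have hcnt' (y : ℕ) : TopologicalSort.indegree d k j (a + 1) y =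
            TopologicalSort.indegree d k j a y := by
          rw [TopologicalSort.indegree_succ, if_neg (fun h => h.2 (h.1.symm.trans hne.symm)),
            Nat.add_zero]
        rw [← hne] at hread htab''
        simp [wp_seq, wp_op, wp_ite, wp_skip, Op.Safe, Op.eval, Test.Holds, hptr', htail, hidx,
          hread, hcnt', hc', -List.headD_eq_head?_getD]
        exact ⟨by omega, by omega, htab''⟩
      · have hcnt' (y : ℕ) : TopologicalSort.indegree d k j (a + 1) y =
            Function.update (ω.arr .cnt) (d j a) (ω.arr .cnt (d j a) + 1) y := by
          rw [TopologicalSort.indegree_succ, Function.update_apply]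
          by_cases e : y = d j a
          · rw [if_pos ⟨e.symm, fun h => hne (h.symm.trans e)⟩, if_pos e, e, hc']
          · rw [if_neg (fun h => e h.1.symm), if_neg e, Nat.add_zero, hc']
        simp [wp_seq, wp_op, wp_ite, wp_skip, Op.Safe, Op.eval, Test.Holds, hptr', htail, hidx,
          hread, hne, hcnt', -List.headD_eq_head?_getD]
        exact ⟨by rw [hc']; omega, by omega, by omega, htab''⟩
    · rintro ω hf' ⟨hptr', hinp', htab', hc'⟩
      rw [hτ'.letters] at hptr' hinp' htab' hc'
      simp only [St.set_v, St.set_arr, St.set_inp, Nat.succ_mul, reduceCtorEq, if_false]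
      refine ⟨hptr', hinp', fun q hq => ?_, htab', fun y => ?_⟩
      · rw [hf'.arr .row (by decide)]
        simp only [Op.eval, St.setArr_arr, if_true, hτj, hptr, Function.update_apply]
        split
        · rename_i e; rw [e]
        · exact hrow q (by omega)
      · rw [hc', TopologicalSort.indegree_next]
  · rintro τ hf ⟨hptr, hinp, hrow, htab, hc⟩
    rw [show (Op.eval τ₁ (.set .ptr 0)).v .size = n from hτ₁.size] at hrow htab hc
    exact ⟨hrow, htab, hc⟩

theorem wp_sortStates {σ : St} (hσ : Header n k s σ) (hV : n * k + n + k + 3 ≤ V)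
    (hrow : ∀ q < n, σ.arr .row q = q * k) (htab : ∀ m < n * k, σ.arr .table m = X m)
    (hcnt : ∀ y, σ.arr .cnt y = TopologicalSort.indegree d k n 0 y)
    (hord : ∀ m, σ.arr .ord m = 0) (hpos : ∀ m, σ.arr .pos m = 0)
    (hX : ∀ q < n, ∀ a < k, X (q * k + a) = d q a) (hdn : ∀ q < n, ∀ a < k, d q a < n)
    (hs : s < n) (hsrc : ∀ q < n, ∀ a < k, d q a = s → q = s)
    (hpred : ∀ x < n, x ≠ s → ∃ q < n, q ≠ x ∧ ∃ a < k, d q a = x)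
    (ρ : ℕ → ℕ) (hρ : ∀ q < n, ∀ a < k, d q a ≠ q → ρ q < ρ (d q a)) :
    wp V sortStates (fun τ => TopologicalSort.Inv d n k s (τ.arr .cnt) (τ.arr .ord) (τ.arr .pos)
      n n 0) σ := by
  unfold sortStates
  rw [wp_seq, wp_op, wp_seq, wp_op]
  refine ⟨trivial, by simp only [Op.Safe]; omega, ?_⟩
  have hσ' := (hσ.frame (Op.frame (.put .ord .zero .start) _) (by decide)).frame
    (Op.frame (.set .tail 1) _) (by decide)
  refine wp_loop (fun h τ => h ≤ τ.v .tail ∧ TopologicalSort.Inv d n k s (τ.arr .cnt) (τ.arr .ord)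
    (τ.arr .pos) (τ.v .tail) h 0) ?_ ?_ ?_
  · have h1 : σ.arr .ord = fun _ => 0 := funext hord
    have h2 : σ.arr .pos = fun _ => 0 := funext hpos
    simpa [Op.eval, hσ.zero, hσ.start, h1, h2] using
      TopologicalSort.Inv.init hs hsrc hpred (fun x _ => hcnt x)
  · rintro h hh τ hf hτh ⟨-, H⟩
    have hτ := hσ'.frame hf (by decide)
    replace hh : h < n := hσ'.size ▸ hh
    have hht := H.lt hh ρ hρ
    have hq := H.ord_lt h hht
    have hrowτ : τ.arr .row = σ.arr .row := by
      rw [hf.arr .row (by decide)]; simp [Op.eval]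
    have htabτ : τ.arr .table = σ.arr .table := by
      rw [hf.arr .table (by decide)]; simp [Op.eval]
    rw [wp_seq, wp_op, wp_seq, wp_op]
    refine ⟨trivial, trivial, ?_⟩
    have hτ' := (hτ.frame (Op.frame (.get .state .ord .idx) _) (by decide)).frame
      (Op.frame (.get .ptr .row .state) _) (by decide)
    refine wp_loop (fun a ω => ω.v .ptr = τ.arr .ord h * k + a ∧ ω.arr .ord h = τ.arr .ord h ∧
      h < ω.v .tail ∧ TopologicalSort.Inv d n k s (ω.arr .cnt) (ω.arr .ord)
      (ω.arr .pos) (ω.v .tail) h a) ?_ ?_ ?_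
    · simp [Op.eval, hτh, hrowτ, hrow _ hq, hht, H]
    · rintro a ha ω hf' hωa ⟨hptr, hordh, hlt, H'⟩
      replace ha : a < k := hτ'.letters ▸ ha
      have hω := hτ'.frame hf' (by decide)
      have hstate : ω.v .state = τ.arr .ord h := by
        rw [hf'.v .state (by decide)]
        simp [Op.eval, hτh]
      have hget : ω.arr .table (τ.arr .ord h * k + a) = d (τ.arr .ord h) a := by
        rw [hf'.arr .table (by decide)]
        simp only [Op.eval, St.set_arr]
        rw [htabτ, htab _ (mul_add_lt hq ha), hX _ hq a ha]
      have hd : d (ω.arr .ord h) a = d (τ.arr .ord h) a := by rw [hordh]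
      have hx := hdn _ hq a ha
      have hptr' := mul_add_lt hq ha
      by_cases hne : τ.arr .ord h = d (τ.arr .ord h) a
      · rw [← hne] at hget hd
        simp [wp_seq, wp_op, wp_ite, wp_skip, Op.Safe, Op.eval, Test.Holds, hptr, hget, hstate,
          hordh, hlt]
        exact ⟨by omega, by omega, H'.step_loop hlt ha (hd.trans hordh.symm)⟩
      · have hne' : d (τ.arr .ord h) a ≠ ω.arr .ord h := by rw [hordh]; exact Ne.symm hne
        by_cases hc : ω.arr .cnt (d (τ.arr .ord h) a) - 1 = 0
        · have H'' := H'.step_push hlt ha hx hd hne' hc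
          have hle := H''.le
          rw [hc] at H''
          simp [wp_seq, wp_op, wp_ite, wp_skip, Op.Safe, Op.eval, Test.Holds, hptr, hget, hstate,
            hne, hω.one, hc]
          refine ⟨by omega, by omega, by omega, ?_, by omega, H''⟩
          rw [Function.update_of_ne hlt.ne, hordh]
        · have H'' := H'.step_dec hlt ha hx hd hne' hc
          simp [wp_seq, wp_op, wp_ite, wp_skip, Op.Safe, Op.eval, Test.Holds, hptr, hget, hstate,
            hne, hω.one, hordh, hlt, H'']
          omega
    · rintro ω hf' ⟨-, -, hlt, H'⟩
      rw [hτ'.letters] at H'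
      simpa using ⟨hlt, H'.next hlt⟩
  · rintro τ hf ⟨hle, H⟩
    rw [hσ'.size] at hle H
    -- After `n` rounds at least `n` states are listed, and there are no more without repetition.
    have := le_antisymm H.le hle
    rwa [this] at H

/-- The transition table after renumbering. -/
def sortedStep (d : ℕ → ℕ → ℕ) (ord pos : ℕ → ℕ) (q a : ℕ) : ℕ := pos (d (ord q) a)

theorem wp_renumberStates {σ : St} {ord pos : ℕ → ℕ} (hσ : Header n k s σ)
    (hV : n * k + n + k + 3 ≤ V)
    (hrow : ∀ q < n, σ.arr .row q = q * k) (htab : ∀ m < n * k, σ.arr .table m = X m)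
    (hord : σ.arr .ord = ord) (hpos : σ.arr .pos = pos) (hlt : ∀ q < n, ord q < n)
    (hX : ∀ q < n, ∀ a < k, X (q * k + a) = d q a) :
    wp V renumberStates (fun τ => ∀ q < n, ∀ a < k,
      τ.arr .sorted (q * k + a) = sortedStep d ord pos q a) σ := by
  unfold renumberStates
  rw [wp_seq, wp_op]
  refine ⟨Nat.zero_le _, ?_⟩
  have hσ' := hσ.frame (Op.frame (.set .ptr2 0) _) (by decide)
  refine wp_loop (fun h τ => τ.v .ptr2 = h * k ∧ ∀ m < h * k,
    τ.arr .sorted m = sortedStep d ord pos (m / k) (m % k)) ?_ ?_ ?_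
  · simp [Op.eval]
  · rintro h hh τ hf hτh ⟨hptr2, hsorted⟩
    have hτ := hσ'.frame hf (by decide)
    replace hh : h < n := hσ'.size ▸ hh
    have hq := hlt h hh
    have hrowτ : τ.arr .row = σ.arr .row := hf.arr .row (by decide)
    have htabτ : τ.arr .table = σ.arr .table := hf.arr .table (by decide)
    have hordτ : τ.arr .ord = ord := (hf.arr .ord (by decide)).trans hord
    have hposτ : τ.arr .pos = pos := (hf.arr .pos (by decide)).trans hpos
    rw [wp_seq, wp_op, wp_seq, wp_op]
    refine ⟨trivial, trivial, ?_⟩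
    have hτ' := (hτ.frame (Op.frame (.get .state .ord .idx) _) (by decide)).frame
      (Op.frame (.get .ptr .row .state) _) (by decide)
    refine wp_loop (fun a ω => ω.v .ptr = ord h * k + a ∧ ω.v .ptr2 = h * k + a ∧
      ∀ m < h * k + a, ω.arr .sorted m = sortedStep d ord pos (m / k) (m % k)) ?_ ?_ ?_
    · simpa [Op.eval, hτh, hrowτ, hordτ, hrow _ hq, hptr2] using hsorted
    · rintro a ha ω hf' hωa ⟨hptr, hptr2', hsorted'⟩
      replace ha : a < k := hτ'.letters ▸ ha
      have hget : ω.arr .table (ord h * k + a) = d (ord h) a := by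
        rw [hf'.arr .table (by decide)]
        simp only [Op.eval, St.set_arr]
        rw [htabτ, htab _ (mul_add_lt hq ha), hX _ hq a ha]
      have hposω : ω.arr .pos = pos := by
        rw [hf'.arr .pos (by decide)]
        simpa [Op.eval] using hposτ
      have h1 := mul_add_lt hq ha
      have h2 := mul_add_lt hh ha
      have hk : 0 < k := by omega
      simp [wp_seq, wp_op, Op.Safe, Op.eval, hptr, hptr2', hget, hposω]
      refine ⟨by omega, by omega, by omega, by omega, fun m hm => ?_⟩
      rw [Function.update_apply]
      split
      · rename_i e
        rw [e, Nat.add_comm, Nat.add_mul_div_right _ _ hk, Nat.add_mul_mod_self_right,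
          Nat.div_eq_of_lt ha, Nat.mod_eq_of_lt ha, Nat.zero_add]
        rfl
      · exact hsorted' m (by omega)
    · rintro ω hf' ⟨-, hptr2', hsorted'⟩
      rw [hτ'.letters] at hptr2' hsorted'
      simpa [Nat.succ_mul, hptr2'] using hsorted'
  · rintro τ hf ⟨-, hsorted⟩ q hq a ha
    rw [hσ'.size] at hsorted
    have hk : 0 < k := by omega
    rw [hsorted _ (mul_add_lt hq ha), Nat.add_comm, Nat.add_mul_div_right _ _ hk,
      Nat.add_mul_mod_self_right, Nat.div_eq_of_lt ha, Nat.mod_eq_of_lt ha, Nat.zero_add]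

end IdealDecomposition

/-! ### Testing consecutive states and printing automata -/

namespace IdealDecomposition

open RAM

variable {n k s V : ℕ} {D : ℕ → ℕ → ℕ}

/-- In the transition table `D`, some letter leads from state `i` to the next state. -/
def EdgeAt (D : ℕ → ℕ → ℕ) (k i : ℕ) : Prop := ∃ a < k, D i a = i + 1

/-- In the transition table `D`, some letter leads from state `i` to `i` or `i + 1`, but is no loop
at state `i + 1`. -/
def GapAt (D : ℕ → ℕ → ℕ) (k i : ℕ) : Prop :=
  ∃ a < k, (D i a = i ∨ D i a = i + 1) ∧ D (i + 1) a ≠ i + 1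

theorem wp_testState {σ : St} {i : ℕ} (hσ : Header n k s σ) (hV : n * k + n + k + 3 ≤ V)
    (hD : ∀ q < n, ∀ a < k, σ.arr .sorted (q * k + a) = D q a)
    (hi : i + 1 < n) (hidx : σ.v .idx = i) (hptr : σ.v .ptr = i * k)
    (hptr2 : σ.v .ptr2 = (i + 1) * k) :
    wp V testState (fun τ => τ.v .idx1 = i + 1 ∧ τ.v .ptr = (i + 1) * k ∧
      τ.v .ptr2 = (i + 2) * k ∧ (τ.v .hasEdge = 0 ↔ ¬ EdgeAt D k i) ∧
      (τ.v .hasGap = 0 ↔ ¬ GapAt D k i)) σ := by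
  unfold testState
  rw [wp_seq, wp_op, wp_seq, wp_op, wp_seq, wp_op]
  refine ⟨by simp only [Op.Safe, hidx, hσ.one]; omega, Nat.zero_le _, Nat.zero_le _, ?_⟩
  have hσ' := ((hσ.frame (Op.frame (.add .idx1 .idx .one) _) (by decide)).frame
    (Op.frame (.set .hasEdge 0) _) (by decide)).frame (Op.frame (.set .hasGap 0) _) (by decide)
  -- `E` and `G` say that no edge or gap occurs among the first letters. They are opaque, so that
  -- simplification sees only their recursion.
  obtain ⟨E, hE⟩ : ∃ E : ℕ → Prop, ∀ a, E a ↔ ∀ b < a, D i b ≠ i + 1 := ⟨_, fun _ => Iff.rfl⟩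
  obtain ⟨G, hG⟩ : ∃ G : ℕ → Prop, ∀ a, G a ↔
      ∀ b < a, D i b = i ∨ D i b = i + 1 → D (i + 1) b = i + 1 := ⟨_, fun _ => Iff.rfl⟩
  have hE' (a : ℕ) : E (a + 1) ↔ E a ∧ D i a ≠ i + 1 := by
    rw [hE, hE, Nat.forall_lt_succ_right]
  have hG' (a : ℕ) : G (a + 1) ↔ G a ∧ (D i a = i ∨ D i a = i + 1 → D (i + 1) a = i + 1) := by
    rw [hG, hG, Nat.forall_lt_succ_right]
  refine wp_loop (fun a τ => τ.v .ptr = i * k + a ∧ τ.v .ptr2 = (i + 1) * k + a ∧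
    (τ.v .hasEdge = 0 ↔ E a) ∧ (τ.v .hasGap = 0 ↔ G a)) ?_ ?_ ?_
  · simp [Op.eval, hptr, hptr2, hE, hG]
  · rintro a ha τ hf hτa ⟨hptr', hptr2', hedge, hgap⟩
    replace ha : a < k := hσ'.letters ▸ ha
    have hidx' : τ.v .idx = i := by
      rw [hf.v .idx (by decide)]; simpa [Op.eval] using hidx
    have hidx1 : τ.v .idx1 = i + 1 := by
      rw [hf.v .idx1 (by decide)]; simp [Op.eval, hidx, hσ.one]
    have hs : τ.arr .sorted = σ.arr .sorted := hf.arr .sorted (by decide)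
    have h1 := hD i (by omega) a ha
    have h2 := hD (i + 1) hi a ha
    have l1 := mul_add_lt (show i < n by omega) ha
    have l2 := mul_add_lt hi ha
    by_cases hx : D i a = i + 1 <;> by_cases hx' : D i a = i <;>
      by_cases hy : D (i + 1) a = i + 1 <;>
      simp [wp_seq, wp_op, wp_ite, wp_skip, Op.Safe, Op.eval, Test.Holds, hptr', hptr2', hidx',
        hidx1, hs, h1, h2, hx, hx', hy, hE', hG', hedge, hgap] <;>
      omega
  · rintro τ hf ⟨hptr', hptr2', hedge, hgap⟩
    rw [hσ'.letters] at hptr' hptr2' hedge hgap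
    refine ⟨?_, by rw [hptr', Nat.succ_mul], by rw [hptr2', ← Nat.succ_mul], ?_, ?_⟩
    · rw [hf.v .idx1 (by decide)]; simp [Op.eval, hidx, hσ.one]
    · rw [hedge, hE]; simp [EdgeAt]
    · rw [hgap, hG]; simp [GapAt]

/-- Among the first `m` states, state `found - 1` is the last one that lacks an edge or a gap, and
`target` is the number of the state to which it can be redirected; if there is no such state, then
`found = 0`. -/
structure Found (D : ℕ → ℕ → ℕ) (n k m found target : ℕ) : Prop where
  le : found ≤ m
  complete : ∀ j < m, found ≤ j → EdgeAt D k j ∧ GapAt D k j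
  -- Once state `found - 1` is removed, the accepting state `n - 1` has number `n - 2`, and state
  -- `found` has number `found - 1`.
  sound : 0 < found → ¬ EdgeAt D k (found - 1) ∧ target = n - 2 ∨
    EdgeAt D k (found - 1) ∧ ¬ GapAt D k (found - 1) ∧ target = found - 1

theorem wp_findState {σ : St} (hσ : Header n k s σ) (hV : n * k + n + k + 3 ≤ V)
    (hD : ∀ q < n, ∀ a < k, σ.arr .sorted (q * k + a) = D q a) :
    wp V findState (fun τ => Found D n k (n - 2) (τ.v .found) (τ.v .target)) σ := by
  unfold findState
  rw [wp_seq, wp_op, wp_seq, wp_op, wp_seq, wp_op]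
  refine ⟨Nat.zero_le _, Nat.zero_le _, trivial, ?_⟩
  have hσ' := ((hσ.frame (Op.frame (.set .found 0) _) (by decide)).frame
    (Op.frame (.set .ptr 0) _) (by decide)).frame (Op.frame (.copy .ptr2 .letters) _) (by decide)
  refine wp_loop (fun i τ => τ.v .ptr = i * k ∧ τ.v .ptr2 = (i + 1) * k ∧
    Found D n k i (τ.v .found) (τ.v .target)) ?_ ?_ ?_
  · refine ⟨by simp [Op.eval], by simp [Op.eval, hσ.letters], ?_⟩
    simp only [Op.eval, St.set_v, reduceCtorEq, if_false, if_true]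
    exact ⟨le_rfl, by simp, by simp⟩
  · rintro i hi τ hf hτi ⟨hptr, hptr2, hfound⟩
    replace hi : i < n - 2 := hσ'.size2 ▸ hi
    have hτ := hσ'.frame hf (by decide)
    have hs : τ.arr .sorted = σ.arr .sorted := hf.arr .sorted (by decide)
    rw [wp_seq]
    refine wp_mono (wp_testState hτ hV (D := D) (by rwa [hs]) (by omega) hτi hptr hptr2) ?_
    rintro ω hf' ⟨hidx1, hptr', hptr2', hedge, hgap⟩
    have hω := hτ.frame hf' (by decide)
    have hidx : ω.v .idx = i := (hf'.v .idx (by decide)).trans hτi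
    rw [← hf'.v .found (by decide), ← hf'.v .target (by decide)] at hfound
    by_cases h1 : EdgeAt D k i
    · by_cases h2 : GapAt D k i
      · simp [wp_seq, wp_op, wp_ite, wp_skip, Op.Safe, Op.eval, Test.Holds, hω.one, hptr', hptr2',
          hedge, hgap, h1, h2]
        refine ⟨hfound.le.trans (Nat.le_succ _), fun j hj hj' => ?_, hfound.sound⟩
        rcases Nat.lt_succ_iff_lt_or_eq.1 hj with hj | rfl
        · exact hfound.complete j hj hj'
        · exact ⟨h1, h2⟩
      · simp [wp_seq, wp_op, wp_ite, wp_skip, Op.Safe, Op.eval, Test.Holds, hω.one, hptr', hptr2',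
          hedge, hgap, h1, h2, hidx, hidx1]
        exact ⟨le_rfl, fun j hj hj' => by omega, fun _ => .inr ⟨h1, h2, rfl⟩⟩
    · simp [wp_seq, wp_op, wp_ite, wp_skip, Op.Safe, Op.eval, Test.Holds, hω.one, hptr', hptr2',
        hedge, h1, hidx1, hω.size2]
      exact ⟨le_rfl, fun j hj hj' => by omega, fun _ => .inl ⟨h1, rfl⟩⟩
  · rintro τ hf ⟨-, -, hfound⟩
    rwa [hσ'.size2] at hfound

theorem wp_printDecision {σ : St} (hσ : Header n k s σ) :
    wp V printDecision (fun τ => τ.out = σ.out ++ [if 0 < σ.v .found then 1 else 0]) σ := by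
  simp [printDecision, wp_seq, wp_op, Op.Safe, Op.eval, hσ.one]
  split <;> omega

/-- The number of a state `y` after state `c` has been removed and redirected to `t`. -/
def renumberFun (c t y : ℕ) : ℕ := if y = c then t else if y < c then y else y - 1

/-- The old number of a state. -/
def oldNumber (c j : ℕ) : ℕ := if j < c then j else j + 1

/-- A row of the transition table after state `c` has been removed and redirected to `t`. -/
def redirectRow (D : ℕ → ℕ → ℕ) (k c t j : ℕ) : List ℕ :=
  (List.range k).map fun a => renumberFun c t (D (oldNumber c j) a)

theorem flatMap_range_succ {β : Type*} (f : ℕ → List β) (j : ℕ) :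
    (List.range (j + 1)).flatMap f = (List.range j).flatMap f ++ f j := by
  simp [List.range_succ]

theorem encodeDFA_redirect {N : ℕ} {M : DFA (Fin k) (Fin (N + 2))} {c : Fin (N + 2)}
    {t : Fin (N + 1)} (hstart : (renumber c t M.start : ℕ) = 0)
    (hacc : ∀ q, q ∈ M.accept ↔ q = Fin.last (N + 1)) (hc : c ≠ Fin.last (N + 1))
    (hD : ∀ q a, (M.step q a : ℕ) = D q a) :
    encodeDFA (redirect M c t) = [N + 1, k, 0] ++ (List.replicate N 0 ++ [1]) ++
      (List.range (N + 1)).flatMap (redirectRow D k c t) := by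
  unfold encodeDFA
  congr 1
  · congr 1
    · exact congrArg (fun z => [N + 1, k, z]) hstart
    · have hmem (q : Fin (N + 1)) : q ∈ (redirect M c t).accept ↔ q = Fin.last N := by
        change c.succAbove q ∈ M.accept ↔ _
        have hl : c.succAbove (Fin.last N) = Fin.last (N + 1) := Fin.succAbove_ne_last_last hc
        rw [hacc, ← hl, Fin.succAbove_right_inj]
      simp only [hmem]
      rw [List.ofFn_succ_last]
      simp [← List.ofFn_const, (Fin.castSucc_lt_last _).ne]
  · rw [List.flatMap, ← ofFn_val]
    congr 2
    funext j
    rw [redirectRow, ← ofFn_val]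
    congr 1
    funext a
    have hj : ((c.succAbove j : Fin (N + 2)) : ℕ) = oldNumber c j := by
      unfold oldNumber Fin.succAbove
      simp only [Fin.lt_def, Fin.val_castSucc]
      split <;> simp
    change ((renumber c t (M.step (c.succAbove j) a) : Fin (N + 1)) : ℕ) = _
    rw [renumber_val, hD, hj]
    rfl

theorem wp_printAutomaton {σ : St} {c t : ℕ} (hσ : Header n k s σ)
    (hV : n * k + n + k + 3 ≤ V)
    (hD : ∀ q < n, ∀ a < k, σ.arr .sorted (q * k + a) = D q a)
    (hc : σ.v .cut = c) (hcn : c < n) (ht : σ.v .target = t) :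
    wp V printAutomaton (fun τ => τ.out = σ.out ++ ([n - 1, k, 0] ++
      (List.replicate (n - 2) 0 ++ [1]) ++ (List.range (n - 1)).flatMap (redirectRow D k c t)))
      σ := by
  unfold printAutomaton
  rw [wp_seq, wp_op, wp_seq, wp_op, wp_seq, wp_op, wp_seq]
  refine ⟨trivial, trivial, trivial, ?_⟩
  have hσ' := ((hσ.frame (Op.frame (.print .size1) _) (by decide)).frame
    (Op.frame (.print .letters) _) (by decide)).frame (Op.frame (.print .zero) _) (by decide)
  refine wp_loop (fun j τ => τ.out = σ.out ++ ([n - 1, k, 0] ++ List.replicate j 0)) ?_ ?_ ?_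
  · simp [Op.eval, hσ.size1, hσ.letters, hσ.zero]
  · intro j hj τ hf hτj hout
    have hτ := hσ'.frame hf (by decide)
    simp [wp_op, Op.Safe, Op.eval, hout, hτ.zero, List.replicate_succ']
  intro τ₀ hf₀ hout₀
  rw [hσ'.size2] at hout₀
  have hτ₀ := hσ'.frame hf₀ (by decide)
  rw [wp_seq, wp_op, wp_seq, wp_op]
  refine ⟨trivial, Nat.zero_le _, ?_⟩
  have hτ₀' := (hτ₀.frame (Op.frame (.print .one) _) (by decide)).frame
    (Op.frame (.set .ptr 0) _) (by decide)
  have hs₀ : τ₀.arr .sorted = σ.arr .sorted := hf₀.arr .sorted (by decide)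
  have hc₀ : τ₀.v .cut = c := (hf₀.v .cut (by decide)).trans hc
  have ht₀ : τ₀.v .target = t := (hf₀.v .target (by decide)).trans ht
  -- At `j = c` the pointer still stands at the removed row, which is skipped inside that round;
  -- hence `j ≤ c` here, in contrast to `j < c` in `oldNumber`.
  refine wp_loop (fun j τ => τ.v .ptr = (if j ≤ c then j else j + 1) * k ∧
    τ.out = σ.out ++ ([n - 1, k, 0] ++ (List.replicate (n - 2) 0 ++ [1]) ++
      (List.range j).flatMap (redirectRow D k c t))) ?_ ?_ ?_
  · simp [Op.eval, hout₀, hτ₀.one]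
  · rintro j hj τ hf hτj ⟨hptr, hout⟩
    replace hj : j < n - 1 := hτ₀'.size1 ▸ hj
    have hτ := hτ₀'.frame hf (by decide)
    have hold : oldNumber c j < n := by unfold oldNumber; split <;> omega
    have hle : oldNumber c j * k ≤ n * k := Nat.mul_le_mul_right k hold.le
    have hcτ : τ.v .cut = c := (hf.v .cut (by decide)).trans hc₀
    rw [wp_seq]
    refine wp_mono (Q := fun τ' => τ'.v .ptr = oldNumber c j * k) ?_ ?_
    · by_cases hjc : j = c
      · have : oldNumber c j = j + 1 := by simp [oldNumber, hjc]
        rw [this, Nat.succ_mul] at hle ⊢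
        rw [if_pos hjc.le] at hptr
        simp [wp_op, wp_ite, wp_skip, Op.Safe, Op.eval, Test.Holds, hτj, hcτ, hjc, hptr,
          hτ.letters]
        rw [← hjc]
        omega
      · have : oldNumber c j = if j ≤ c then j else j + 1 := by
          unfold oldNumber
          split <;> split <;> omega
        simp [wp_op, wp_ite, wp_skip, Test.Holds, hτj, hcτ, hjc, hptr, this]
    · intro τ' hf' hptr'
      have hτ' := hτ.frame hf' (by decide)
      have hout' : τ'.out = τ.out := hf'.out (by decide)
      refine wp_loop (fun a ω => ω.v .ptr = oldNumber c j * k + a ∧ ω.out = τ.out ++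
        (List.range a).map fun a => renumberFun c t (D (oldNumber c j) a)) ?_ ?_ ?_
      · simp [hptr', hout']
      · rintro a ha ω hf'' hωa ⟨hptr'', hout''⟩
        replace ha : a < k := hτ'.letters ▸ ha
        have hω := hτ'.frame hf'' (by decide)
        have hlt := mul_add_lt hold ha
        have hget : ω.arr .sorted (oldNumber c j * k + a) = D (oldNumber c j) a := by
          rw [hf''.arr .sorted (by decide), hf'.arr .sorted (by decide),
            hf.arr .sorted (by decide)]
          simp only [Op.eval, St.set_arr, hs₀]
          exact hD _ hold a ha
        have hcω : ω.v .cut = c := by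
          rw [hf''.v .cut (by decide), hf'.v .cut (by decide), hcτ]
        have htω : ω.v .target = t := by
          rw [hf''.v .target (by decide), hf'.v .target (by decide), hf.v .target (by decide)]
          exact ht₀
        rcases lt_trichotomy (D (oldNumber c j) a) c with h | h | h
        · simp [wp_seq, wp_op, wp_ite, Op.Safe, Op.eval, Test.Holds, hptr'', hget,
            hcω, h, hout'', List.range_succ, renumberFun, h.ne]
          omega
        · simp [wp_seq, wp_op, wp_ite, Op.Safe, Op.eval, Test.Holds, hptr'', hget,
            hcω, h, hout'', List.range_succ, renumberFun, htω]
          omega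
        · simp [wp_seq, wp_op, wp_ite, Op.Safe, Op.eval, Test.Holds, hptr'', hget,
            hcω, h, hout'', List.range_succ, renumberFun, h.ne', h.le, hω.one]
          omega
      · rintro ω hf'' ⟨hptr'', hout''⟩
        rw [hτ'.letters] at hptr'' hout''
        refine ⟨?_, ?_⟩
        · simp only [St.set_v, reduceCtorEq, if_false, hptr'']
          rw [← Nat.succ_mul]
          unfold oldNumber
          congr 1
          split <;> split <;> omega
        · simp only [St.set_out, hout'', hout, flatMap_range_succ, redirectRow, List.append_assoc]
  · rintro τ hf ⟨-, hout⟩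
    rw [hτ₀'.size1] at hout
    exact hout

end IdealDecomposition

/-! ### From the computed numbers back to automata -/

namespace IdealDecomposition

open RAM

variable {n k V : ℕ}

theorem renumber_zero {N : ℕ} {c : Fin (N + 2)} {t : Fin (N + 1)} (h : (c : ℕ) = 0 → (t : ℕ) = 0) :
    (renumber c t 0 : ℕ) = 0 := by
  rw [renumber_val, Fin.val_zero]
  split
  · rename_i h0
    exact h h0.symm
  · split <;> rfl

theorem edgeAt_stepFun {M : DFA (Fin k) (Fin n)} (p : Fin n) :
    EdgeAt (stepFun M) k p ↔ HasEdge M p := by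
  constructor
  · rintro ⟨a, ha, h⟩
    exact ⟨⟨a, ha⟩, by rw [← stepFun_eq, h]⟩
  · rintro ⟨a, h⟩
    exact ⟨a, a.isLt, by rw [stepFun_eq, h]⟩

theorem gapAt_stepFun {M : DFA (Fin k) (Fin n)} {p q : Fin n} (hpq : (q : ℕ) = p + 1) :
    GapAt (stepFun M) k p ↔ HasGap M p q := by
  simp only [HasGap, Fin.ext_iff, ne_eq, ← stepFun_eq, hpq]
  constructor
  · rintro ⟨a, ha, h⟩
    exact ⟨⟨a, ha⟩, h⟩
  · rintro ⟨a, h⟩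
    exact ⟨a, a.isLt, h⟩

theorem Found.not_hasIntersectionDecomposition {N t : ℕ} {M : DFA (Fin k) (Fin (N + 2))}
    (hM : IsOrdered M) (h : Found (stepFun M) (N + 2) k N 0 t) :
    ¬ HasIntersectionDecomposition M :=
  hM.not_hasIntersectionDecomposition (Nat.succ_pos N) fun p q hpq hq => by
    rw [← edgeAt_stepFun, ← gapAt_stepFun hpq]
    exact h.complete p (by omega) (Nat.zero_le _)

/-- The decomposition that belongs to the state `f`, the first of the two automata being obtained by
redirecting to `t`. -/
def decomposition {N : ℕ} (M : DFA (Fin k) (Fin (N + 2))) (f t : ℕ) (hf : f ≤ N) (ht : t ≤ N) :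
    List ((m : ℕ) × DFA (Fin k) (Fin m)) :=
  [⟨N + 1, redirect M ⟨f - 1, by omega⟩ ⟨t, by omega⟩⟩,
    ⟨N + 1, redirect M ⟨f, by omega⟩ ⟨f, by omega⟩⟩]

theorem Found.target_le {N f t : ℕ} {D : ℕ → ℕ → ℕ} (h : Found D (N + 2) k N f t) (hf : 0 < f) :
    t ≤ N := by
  have := h.le
  rcases h.sound hf with ⟨-, h⟩ | ⟨-, -, h⟩ <;> omega

theorem Found.isIntersectionDecomposition {N f t : ℕ} {M : DFA (Fin k) (Fin (N + 2))}
    (hM : IsOrdered M) (h : Found (stepFun M) (N + 2) k N f t) (hf : 0 < f) :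
    IsIntersectionDecomposition M (decomposition M f t h.le (h.target_le hf)) := by
  have hle := h.le
  have hpq : ((⟨f, by omega⟩ : Fin (N + 2)) : ℕ) = (⟨f - 1, by omega⟩ : Fin (N + 2)) + 1 := by
    simp only; omega
  -- The failing state `p` is `f - 1`, so `f` plays the role of `q`.
  refine hM.isIntersectionDecomposition (r := ⟨f + 1, by omega⟩) hpq rfl ?_ ?_ ?_
  · intro j hj hjN
    rw [Fin.lt_def] at hj
    rw [← edgeAt_stepFun]
    simp only at hj
    exact (h.complete j (by omega) (by omega)).1
  · have hsound := h.sound hf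
    rw [show f - 1 = ((⟨f - 1, by omega⟩ : Fin (N + 2)) : ℕ) from rfl, edgeAt_stepFun,
      gapAt_stepFun hpq] at hsound
    refine hsound.imp (And.imp_right fun ht => ?_) (And.imp_right (And.imp_right fun ht => ?_))
    · rw [Fin.succAbove_of_le_castSucc _ _ (by rw [Fin.le_def]; simp [ht]; omega)]
      exact Fin.ext (by simp [ht])
    · rw [Fin.succAbove_of_le_castSucc _ _ (by rw [Fin.le_def]; simp [ht])]
      exact Fin.ext (by simp [ht]; omega)
  · rw [Fin.succAbove_of_le_castSucc _ _ (by rw [Fin.le_def]; simp)]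
    rfl

theorem wp_readHeader (M : DFA (Fin k) (Fin n)) (hV : n * k + n + k + 3 ≤ V) :
    wp V readHeader (fun τ => Header n k M.start τ ∧ τ.inp = (encodeDFA M).drop 3 ∧
      (∀ A i, τ.arr A i = 0) ∧ τ.out = []) ⟨fun _ => 0, fun _ _ => 0, encodeDFA M, []⟩ := by
  rw [encodeDFA_eq_cons M]
  simp [readHeader, wp_seq, wp_op, Op.Safe, Op.eval]
  refine ⟨by omega, ?_⟩
  constructor <;> simp
  omega

/-- The order of the states found by topological sorting. -/
theorem exists_equiv_of_inv {M : DFA (Fin k) (Fin n)} {cnt ord pos : ℕ → ℕ}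
    (H : TopologicalSort.Inv (stepFun M) n k M.start cnt ord pos n n 0) :
    ∃ e : Fin n ≃ Fin n, (e M.start : ℕ) = 0 ∧ (∀ q a, e q ≤ e (M.step q a)) ∧
      ∀ q < n, ∀ a < k, sortedStep (stepFun M) ord pos q a = stepFun (DFA.reindex e M) q a := by
  -- With all `n` states listed, `ord` is a bijection from new to old numbers, and `pos` is its
  -- inverse.
  let f : Fin n → Fin n := fun i => ⟨ord i, H.ord_lt i i.isLt⟩
  have hf : Function.Injective f := fun i j hij =>
    Fin.ext (H.inj i.isLt j.isLt (congrArg Fin.val hij))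
  let e := (Equiv.ofBijective f (Finite.injective_iff_bijective.1 hf)).symm
  have hsymm (i : Fin n) : e.symm i = f i := rfl
  have hval (q : Fin n) : (e q : ℕ) = pos q := by
    have h : f (e q) = q := e.symm_apply_apply q
    rw [← H.pos_ord _ (e q).isLt]
    exact congrArg pos (congrArg Fin.val h)
  refine ⟨e, by rw [hval, H.pos_zero], fun q a => ?_, fun q hq a ha => ?_⟩
  · by_cases hqa : M.step q a = q
    · rw [hqa]
    · have h1 : ord (e (M.step q a)) = M.step q a :=
        congrArg Fin.val (e.symm_apply_apply (M.step q a))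
      obtain ⟨i, hi, hiq⟩ := H.pred _ (e (M.step q a)).isLt q q.isLt a a.isLt
        (by rw [stepFun_eq, h1]) (by rw [h1]; exact fun h => hqa (Fin.ext h.symm))
      rw [Fin.le_def, hval q, ← hiq, H.pos_ord i (hi.trans (e _).isLt)]
      exact hi.le
  · have h2 : (DFA.reindex e M).step ⟨q, hq⟩ ⟨a, ha⟩ = e (M.step (e.symm ⟨q, hq⟩) ⟨a, ha⟩) := rfl
    have h3 := stepFun_eq (DFA.reindex e M) ⟨q, hq⟩ ⟨a, ha⟩
    have h4 := stepFun_eq M (e.symm ⟨q, hq⟩) ⟨a, ha⟩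
    rw [h2, hval, ← h4] at h3
    exact h3.symm

/-- What is known after the analysis of the automaton `M`. -/
def Analyzed (M : DFA (Fin k) (Fin n)) (τ : St) : Prop :=
  ∃ e : Fin n ≃ Fin n, (e M.start : ℕ) = 0 ∧ (∀ q a, e q ≤ e (M.step q a)) ∧
    (∀ q < n, ∀ a < k, τ.arr .sorted (q * k + a) = stepFun (DFA.reindex e M) q a) ∧
    Found (stepFun (DFA.reindex e M)) n k (n - 2) (τ.v .found) (τ.v .target)

theorem wp_analyze {M : DFA (Fin k) (Fin n)} (hM : IsMinimal M) (hI : IsIdeal M.accepts)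
    (hV : n * k + n + k + 3 ≤ V) {σ : St} (hσ : Header n k M.start σ)
    (hinp : σ.inp = (encodeDFA M).drop 3) (harr : ∀ A i, σ.arr A i = 0) :
    wp V analyze (Analyzed M) σ := by
  have hX : ∀ q < n, ∀ a < k, (encodeDFA M).getD (3 + n + (q * k + a)) 0 = stepFun M q a :=
    fun q hq a ha => getD_encodeDFA M hq ha
  unfold analyze
  rw [wp_seq]
  refine wp_mono (wp_readTable (X := fun m => (encodeDFA M).getD (3 + n + m) 0) (d := stepFun M)
    hσ hV hinp (fun _ => rfl) hX (harr _)) ?_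
  rintro τ hf ⟨hrow, htab, hcnt⟩
  have hτ := hσ.frame hf (by decide)
  rw [wp_seq]
  obtain ⟨ρ, hρ⟩ := hM.exists_rank hI
  refine wp_mono (wp_sortStates (d := stepFun M) hτ hV hrow htab hcnt
    (fun m => by rw [hf.arr .ord (by decide), harr])
    (fun m => by rw [hf.arr .pos (by decide), harr])
    hX (fun q hq a _ => stepFun_lt M a hq) M.start.isLt ?_ ?_
    (fun q => if h : q < n then ρ ⟨q, h⟩ else 0) ?_) ?_
  · intro q hq a ha h
    rw [stepFun_eq M ⟨q, hq⟩ ⟨a, ha⟩] at h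
    exact congrArg Fin.val (hM.eq_start_of_step hI (Fin.ext h))
  · intro x hx hxs
    obtain ⟨p, hp, a, ha⟩ := hM.exists_pred (q := ⟨x, hx⟩) fun h => hxs (congrArg Fin.val h)
    refine ⟨p, p.isLt, fun h => hp (Fin.ext h), a, a.isLt, ?_⟩
    rw [stepFun_eq, ha]
  · intro q hq a ha h
    have hlt := stepFun_lt M a hq
    have hs := stepFun_eq M ⟨q, hq⟩ ⟨a, ha⟩
    have := hρ ⟨q, hq⟩ ⟨a, ha⟩ fun h' => h (by rw [hs, h'])
    rw [dif_pos hq, dif_pos hlt]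
    convert this using 2
    exact Fin.ext hs
  intro τ₁ hf₁ H
  have hτ₁ := hτ.frame hf₁ (by decide)
  obtain ⟨e, he0, he, hstep⟩ := exists_equiv_of_inv H
  rw [wp_seq]
  refine wp_mono (wp_renumberStates (d := stepFun M) hτ₁ hV
    (by rw [hf₁.arr .row (by decide)]; exact hrow)
    (by rw [hf₁.arr .table (by decide)]; exact htab) rfl rfl H.ord_lt hX) ?_
  intro τ₂ hf₂ hsorted
  have hτ₂ := hτ₁.frame hf₂ (by decide)
  replace hsorted : ∀ q < n, ∀ a < k, τ₂.arr .sorted (q * k + a) =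
      stepFun (DFA.reindex e M) q a := fun q hq a ha => by rw [hsorted q hq a ha, hstep q hq a ha]
  refine wp_mono (wp_findState hτ₂ hV hsorted) ?_
  intro τ₃ hf₃ hfound
  exact ⟨e, he0, he, by rwa [hf₃.arr .sorted (by decide)], hfound⟩

theorem Analyzed.found_pos_iff {M : DFA (Fin k) (Fin n)} (hM : IsMinimal M)
    (hI : IsIdeal M.accepts) {τ : St} (h : Analyzed M τ) :
    0 < τ.v .found ↔ HasIntersectionDecomposition M := by
  obtain ⟨e, he0, he, -, hf⟩ := h
  obtain _ | _ | N := n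
  · exact M.start.elim0
  -- For a single state a factor would have no states at all, hence no initial state.
  · have := hf.le
    constructor
    · omega
    · rintro ⟨D, hD, hlt, -⟩
      obtain ⟨⟨m, B⟩, hB⟩ := List.exists_mem_of_ne_nil D hD
      have := (hlt _ hB).1
      have := B.start.isLt
      simp only [Fintype.card_fin] at *
      omega
  · have hO := hM.isOrdered hI (Nat.succ_pos N) e (Fin.ext he0) he
    rw [← hasIntersectionDecomposition_reindex e]
    constructor
    · exact fun h => ⟨_, hf.isIntersectionDecomposition hO h⟩
    · intro h
      by_contra h0
      obtain h0 : τ.v .found = 0 := by omega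
      rw [h0] at hf
      exact hf.not_hasIntersectionDecomposition hO h

theorem wp_printDecomposition {N s f t : ℕ} {M : DFA (Fin k) (Fin (N + 2))} (hM : IsOrdered M)
    (hV : (N + 2) * k + (N + 2) + k + 3 ≤ V) {σ : St} (hσ : Header (N + 2) k s σ)
    (hD : ∀ q < N + 2, ∀ a < k, σ.arr .sorted (q * k + a) = stepFun M q a)
    (h : Found (stepFun M) (N + 2) k N f t) (hf : 0 < f) (hvf : σ.v .found = f)
    (hvt : σ.v .target = t) (hout : σ.out = []) :
    wp V printDecomposition (fun τ => τ.out =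
      encodeList (decomposition M f t h.le (h.target_le hf))) σ := by
  have hle := h.le
  have htN := h.target_le hf
  have henc1 : encodeDFA (redirect M ⟨f - 1, by omega⟩ ⟨t, by omega⟩) = _ :=
    encodeDFA_redirect (D := stepFun M) (by
      rw [hM.start]
      refine renumber_zero fun h0 => ?_
      simp only at h0 ⊢
      rcases h.sound hf with ⟨he, -⟩ | ⟨-, -, ht⟩
      -- State `0` does have an edge, because the smaller predecessor of state `1` can only be `0`.
      -- So the initial state is never redirected to the accepting one, and the printed initial
      -- state `0` is right.
      · exfalso
        obtain ⟨p, hp, a, ha⟩ := hM.pred 1 (by simp)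
        refine he ?_
        rw [h0]
        refine (edgeAt_stepFun (0 : Fin (N + 2))).2 ⟨a, ?_⟩
        have hp0 : p = 0 := by
          rw [Fin.lt_def, Fin.val_one] at hp
          exact Fin.ext (by rw [Fin.val_zero]; omega)
        rw [← hp0, ha, hp0]
        simp
      · omega) hM.accept (by rw [Ne, Fin.ext_iff, Fin.val_last]; simp only; omega)
      (fun q a => (stepFun_eq M q a).symm)
  have henc2 : encodeDFA (redirect M ⟨f, by omega⟩ ⟨f, by omega⟩) = _ :=
    encodeDFA_redirect (D := stepFun M) (by
      rw [hM.start]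
      exact renumber_zero fun h0 => absurd h0 hf.ne') hM.accept (by rw [Ne, Fin.ext_iff, Fin.val_last]; simp only; omega)
      (fun q a => (stepFun_eq M q a).symm)
  unfold printDecomposition
  rw [wp_seq, wp_op, wp_seq, wp_op, wp_seq, wp_op, wp_seq]
  refine ⟨by simp only [Op.Safe]; omega, trivial, trivial, ?_⟩
  have hσ' := ((hσ.frame (Op.frame (.set .val 2) _) (by decide)).frame
    (Op.frame (.print .val) _) (by decide)).frame (Op.frame (.sub .cut .found .one) _) (by decide)
  refine wp_mono (wp_printAutomaton (c := f - 1) (t := t) (D := stepFun M) hσ' hV hD ?_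
    (by omega) hvt) ?_
  · simp [Op.eval, hvf, hσ.one]
  intro τ hf₁ hout₁
  have hτ := hσ'.frame hf₁ (by decide)
  rw [wp_seq, wp_op, wp_seq, wp_op]
  refine ⟨trivial, trivial, ?_⟩
  have hτ' := (hτ.frame (Op.frame (.copy .target .found) _) (by decide)).frame
    (Op.frame (.copy .cut .found) _) (by decide)
  have hvf₁ : τ.v .found = f := (hf₁.v .found (by decide)).trans hvf
  refine wp_mono (wp_printAutomaton (c := f) (t := f) (D := stepFun M) hτ' hV ?_ ?_ (by omega) ?_)
    ?_
  · simp only [Op.eval, St.set_arr]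
    rw [hf₁.arr .sorted (by decide)]
    exact hD
  · simp [Op.eval, hvf₁]
  · simp [Op.eval, hvf₁]
  intro ω hf₂ hout₂
  rw [hout₂]
  simp only [Op.eval, St.set_out, hout₁]
  simp [encodeList, decomposition, henc1, henc2, hout]

end IdealDecomposition

/-! ### Running time and word length -/

namespace IdealDecomposition

open RAM

/-- The decision algorithm after the header has been read. -/
def decideBody : Cmd := .seq analyze printDecision

/-- The decomposition algorithm after the header has been read. -/
def decomposeBody : Cmd := .seq analyze printDecomposition

/-- Bounds for the loop bounds. -/
def sizeBound (n k : ℕ) (x : Var) : ℕ := if x = .letters then k else n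

theorem cost_decideBody (n k : ℕ) :
    decideBody.cost (sizeBound n k) ≤ 1000 * (n * k) + 1000 * n + 1000 := by
  simp [decideBody, analyze, readTable, sortStates, renumberStates, findState, testState,
    printDecision, Cmd.cost, sizeBound, Op.code, Test.code]
  ring_nf
  omega

/-- Just two tables of fewer than `n` rows are printed, so the construction is linear in `n * k` as
well. -/
theorem cost_decomposeBody (n k : ℕ) :
    decomposeBody.cost (sizeBound n k) ≤ 1000 * (n * k) + 1000 * n + 1000 := by
  simp [decomposeBody, analyze, readTable, sortStates, renumberStates, findState, testState,
    printDecomposition, printAutomaton, Cmd.cost, sizeBound, Op.code, Test.code]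
  ring_nf
  omega

/-- Without letters only the initial state is accessible. The estimate absorbs the summand linear in
`n` into the time bound. -/
theorem IsMinimal.le_mul_add_one {n k : ℕ} {M : DFA (Fin k) (Fin n)} (hM : IsMinimal M) :
    n ≤ n * k + 1 := by
  rcases Nat.eq_zero_or_pos k with rfl | hk
  · have h (q : Fin n) : q = M.start := by
      obtain ⟨w, rfl⟩ := hM.accessible q
      rw [Subsingleton.elim w []]
      rfl
    have : Subsingleton (Fin n) := ⟨fun p q => (h p).trans (h q).symm⟩
    have := Fintype.card_le_one_iff_subsingleton.2 this
    rw [Fintype.card_fin] at this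
    omega
  · exact (Nat.le_mul_of_pos_right n hk).trans (Nat.le_succ _)

/-- The running time and the memory contents of an algorithm that starts by reading the header. -/
theorem computesWithin_of_wp {n k T : ℕ} {M : DFA (Fin k) (Fin n)} (hM : IsMinimal M) {c : Cmd}
    (hw : c.WF) (hc : ∀ y ∈ c.limits, y ∉ c.writes ∧ y ∈ [Var.size, .letters, .size1, .size2])
    (hT : c.cost (sizeBound n k) ≤ 1000 * (n * k) + 1000 * n + 1000) (hT' : 4000 * (n * k + 1) ≤ T)
    {y : List ℕ}
    (h : wp (n * k + n + k + 3) c (fun τ => τ.out = y)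
      (readHeader.eval ⟨fun _ => 0, fun _ _ => 0, encodeDFA M, []⟩)) :
    ComputesWithin ((Cmd.seq readHeader c).code 0) (encodeDFA M) y T ((n * k + 2) ^ 6) := by
  obtain ⟨hs, hH, -⟩ := wp_readHeader M (le_refl (n * k + n + k + 3))
  have hn := hM.le_mul_add_one
  have hk : k ≤ n * k := Nat.le_mul_of_pos_left k M.start.pos
  have key : wp (n * k + n + k + 3) (.seq readHeader c) (fun τ => τ.out = y)
      ⟨fun _ => 0, fun _ _ => 0, encodeDFA M, []⟩ := wp_seq.2 ⟨hs, h⟩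
  have hwf : (Cmd.seq readHeader c).WF := ⟨by decide, hw⟩
  rw [← key.2]
  refine Cmd.computesWithin hwf (fun m hm => ?_) key.1 (le_trans ?_ hT') ?_
  · have := le_of_mem_encodeDFA M hm
    omega
  · have h1 : readHeader.time ⟨fun _ => 0, fun _ _ => 0, encodeDFA M, []⟩ = 6 := rfl
    have h2 := c.time_le_cost c.writes (sizeBound n k) (List.Subset.refl _)
      (readHeader.eval ⟨fun _ => 0, fun _ _ => 0, encodeDFA M, []⟩) fun y hy => by
        obtain ⟨hy1, hy2⟩ := hc y hy
        refine ⟨hy1, ?_⟩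
        simp only [List.mem_cons, List.not_mem_nil, or_false] at hy2
        rcases hy2 with rfl | rfl | rfl | rfl
        · rw [hH.size]; simp [sizeBound]
        · rw [hH.letters]; simp [sizeBound]
        · rw [hH.size1]; simp [sizeBound]
        · rw [hH.size2]; simp [sizeBound]
    simp only [Cmd.time, h1]
    omega
  -- With `V = n * k + n + k + 3 ≤ 3 * (n * k) + 4`, memory contents are at most `8 * V + 7 ≤ 2 ^ 5
  -- * (n * k + 2)`; five factors of the power pay for `2 ^ 5`.
  · have h1 : 2 ^ 5 ≤ (n * k + 2) ^ 5 := Nat.pow_le_pow_left (by omega) 5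
    have h2 : 2 ^ 5 * (n * k + 2) ≤ (n * k + 2) ^ 6 := by
      rw [pow_succ (n * k + 2) 5]
      exact Nat.mul_le_mul_right _ h1
    omega

end IdealDecomposition

open scoped Classical in
/-- The size of the automaton is `n`, and `k` is the number of letters. The bounds `O(n k)` and
`O(n k ^ 2)` carry a `+ 1` for the empty alphabet only. All numbers are at most
`(n * k + 2) ^ c`: words of `O(log (n k))` bits suffice. -/
theorem theorem2 :
    (∃ (P : RAM.Program) (C c : ℕ), ∀ (n k : ℕ) (A : DFA (Fin k) (Fin n)),
      IdealDecomposition.IsMinimal A → IdealDecomposition.IsIdeal A.accepts →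
        RAM.ComputesWithin P (IdealDecomposition.encodeDFA A)
          (if IdealDecomposition.HasIntersectionDecomposition A then [1] else [0])
          (C * (n * k + 1)) ((n * k + 2) ^ c)) ∧
    (∃ (P : RAM.Program) (C c : ℕ), ∀ (n k : ℕ) (A : DFA (Fin k) (Fin n)),
      IdealDecomposition.IsMinimal A → IdealDecomposition.IsIdeal A.accepts →
        IdealDecomposition.HasIntersectionDecomposition A →
          ∃ D : List ((m : ℕ) × DFA (Fin k) (Fin m)),
            IdealDecomposition.IsIntersectionDecomposition A D ∧
            RAM.ComputesWithin P (IdealDecomposition.encodeDFA A)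
              (IdealDecomposition.encodeList D)
              (C * (n * k ^ 2 + 1)) ((n * k + 2) ^ c)) := by
  open IdealDecomposition RAM in
  refine ⟨⟨(Cmd.seq readHeader decideBody).code 0, 4000, 6, fun n k A hM hI => ?_⟩,
    ⟨(Cmd.seq readHeader decomposeBody).code 0, 4000, 6, fun n k A hM hI hA => ?_⟩⟩
  · refine computesWithin_of_wp hM (by decide) (by decide) (cost_decideBody n k) le_rfl ?_
    obtain ⟨-, hσ, hinp, harr, hout⟩ := wp_readHeader A (le_refl (n * k + n + k + 3))
    unfold decideBody
    rw [wp_seq]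
    refine wp_mono (wp_analyze hM hI le_rfl hσ hinp harr) fun τ hf hτ => ?_
    refine wp_mono (wp_printDecision (hσ.frame hf (by decide))) fun ω _ hω => ?_
    rw [hω, hf.out (by decide), hout]
    simp only [hτ.found_pos_iff hM hI]
    split <;> rfl
  · obtain ⟨-, hσ, hinp, harr, hout⟩ := wp_readHeader A (le_refl (n * k + n + k + 3))
    obtain ⟨hs, hτ⟩ := wp_analyze hM hI le_rfl hσ hinp harr
    have hpos := (hτ.found_pos_iff hM hI).2 hA
    obtain ⟨e, he0, he, hD, hF⟩ := hτ
    obtain _ | _ | N := n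
    · exact A.start.elim0
    · exact absurd (Nat.le_zero.1 hF.le) hpos.ne'
    · have hO := hM.isOrdered hI (Nat.succ_pos N) e (Fin.ext he0) he
      refine ⟨_, (isIntersectionDecomposition_reindex e).1 (hF.isIntersectionDecomposition hO hpos),
        computesWithin_of_wp hM (by decide) (by decide) (cost_decomposeBody _ _) ?_ ?_⟩
      -- The time is in fact linear in `n * k`; `k ≤ k ^ 2` gives the stated bound.
      · have hk := Nat.le_self_pow two_ne_zero k
        have := Nat.mul_le_mul_left (N + 1 + 1) hk
        omega
      · unfold decomposeBody
        rw [wp_seq]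
        have hf := analyze.frame (readHeader.eval ⟨fun _ => 0, fun _ _ => 0, encodeDFA A, []⟩)
        exact ⟨hs, wp_printDecomposition hO le_rfl (hσ.frame hf (by decide)) hD hF hpos rfl rfl
          (by rw [hf.out (by decide), hout])⟩
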